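/- Let $R$ be a finite commutative local ring, and let $\xi$ be a probability distribution on $R$ such that (i) $\xi$ is not concentrated on a translate $a+I$ of a proper ideal $I\subsetneq R$ (with $a\in R$); (ii) $\xi$ is not concentrated on an affine translate $a+cS=\{a+cs : s\in S\}$ of a proper subring $S\subsetneq R$, with $a\in R$ and $c\in R^{\times}$. For each $n$, let $\mathcal{M}_{n,n}$ be a random $n\times n$ matrix over $R$ whose entries are independent with distribution $\xi$, and let $\mathcal{U}_{n,n}$ be a random $n\times n$ matrix over $R$ whose entries are independent and uniformly distributed on $R$. Then $\det(\mathcal{M}_{n,n})$ has asymptotically the same distribution as $\det(\mathcal{U}_{n,n})$: the total variation distance between the laws, $$\sup_{A\subseteq R}\bigl|\mathbb{P}(\det \mathcal{M}_{n,n}\in A)-\mathbb{P}(\det \mathcal{U}_{n,n}\in A)\bigr|,$$ tends to $0$ as $n\to\infty$. -/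

import Mathlib

open MeasureTheory ProbabilityTheory

/-- Total variation distance `sup_A |μ(A) - ν(A)|` of two probability measures. -/
noncomputable def tvDist {X : Type*} [MeasurableSpace X] (μ ν : Measure X) : ℝ :=
  ⨆ A : {A : Set X // MeasurableSet A}, |μ.real A - ν.real A|

/-- `M` is a random `n × n` matrix whose entries are independent and all have law `ξ`. -/
def IsIIDMatrix {Ω R : Type*} [MeasurableSpace Ω] [MeasurableSpace R] {n : ℕ}
    (M : Ω → Matrix (Fin n) (Fin n) R) (ξ : Measure R) (P : Measure Ω) : Prop :=
  (∀ i j, HasLaw (fun ω => M ω i j) ξ P) ∧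
    iIndepFun (fun (ij : Fin n × Fin n) (ω : Ω) => M ω ij.1 ij.2) P

/-- `ξ` is not concentrated on a translate `a + I` of a proper ideal `I`. -/
def NotOnIdealTranslate {R : Type*} [CommRing R] [MeasurableSpace R] (ξ : Measure R) : Prop :=
  ∀ I : Ideal R, I ≠ ⊤ → ∀ a : R, ¬ ∀ᵐ x ∂ξ, x ∈ (fun y => a + y) '' (I : Set R)

/-- `ξ` is not concentrated on an affine translate `a + c S` of a proper subring `S`
(`c` a unit). This is the form of the condition that is invariant under translating `ξ` and
under multiplying it by a unit. -/
def NotOnSubringTranslate {R : Type*} [CommRing R] [MeasurableSpace R] (ξ : Measure R) : Prop :=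
  ∀ S : Subring R, S ≠ ⊤ → ∀ (a : R) (c : Rˣ),
    ¬ ∀ᵐ x ∂ξ, x ∈ (fun y => a + (c : R) * y) '' (S : Set R)

namespace RandomDeterminant

open Finset
open scoped Classical

/-! For a large fixed `k`, the determinant of a random `(m + k) × (m + k)` matrix is shown to be
close in law to that of a uniform `k × k` matrix. The argument uses only that the entry law is
nondegenerate (`IsSpreadWeight`), so it applies both to `ξ` and to the uniform law, and the two
determinants are compared through this common limit.

Split the matrix as `[A | C]` with `A` of width `m`. If `A` is injective modulo the maximal ideal,
some invertible `G` sends `A` to an identity block over zero. With `φ` the last `k` rows of `G`,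
`det G * det [A | C] = det (φ C)`. The columns of `C` are independent of `A`, and Fourier inversion
on `R^k` makes `φ C` nearly uniform as soon as every nonzero character pulled back along `φ` has
many coordinates that are not constant on the support of the law. These pullbacks annihilate the
columns of `A`. Finally the unit `det G` does not affect the uniform determinant law.

So `A` must have two properties. Residual injectivity fails with probability at most about `s ^ k`,
`s` being the density of the maximal ideal; this is why `k` is taken large. Absence of mostly flat
annihilating families holds with probability tending to one, by a first moment bound. Its core is
`IsSpreadWeight.eq_univ_or_card_lt`. Fix the set `T` of those `r` for which `r • ψ` is mostly flat.
About `|D| ^ m` families `ψ` have this `T`, where `D` consists of the characters trivial on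
`diffSpan w T`, while each is orthogonal to a random vector with probability about `|T| / |R|`.
Since `|D| * |diffSpan w T| ≤ |R|`, the sum decays exponentially once `diffSpan w T` is strictly
larger than `T`, and equality would force the law onto an affine image of a proper subring unless
`T` is everything. -/

/-- A probability mass function with real values. -/
structure IsWeight {R : Type*} [Fintype R] (w : R → ℝ) : Prop where
  nonneg : ∀ x, 0 ≤ w x
  sum_eq_one : ∑ x, w x = 1

/-- The probability of a vector with i.i.d. entries of law `w`. -/
noncomputable def vecWeight {R ι : Type*} [Fintype ι] (w : R → ℝ) (a : ι → R) : ℝ :=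
  ∏ i, w (a i)

/-- The probability of a matrix with i.i.d. entries of law `w`. -/
noncomputable def matWeight {R ι κ : Type*} [Fintype ι] [Fintype κ] (w : R → ℝ)
    (A : Matrix ι κ R) : ℝ :=
  ∏ i, vecWeight w (A.row i)

theorem matWeight_transpose {R ι κ : Type*} [Fintype ι] [Fintype κ] (w : R → ℝ) (A : Matrix ι κ R) :
    matWeight w A.transpose = matWeight w A := by
  simp only [matWeight, vecWeight, Matrix.row_apply, Matrix.transpose_apply]
  exact Finset.prod_comm

theorem sum_biUnion_le_sum {α β : Type*} [DecidableEq β] (s : Finset α) (t : α → Finset β) {f : β → ℝ}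
    (hf : ∀ x, 0 ≤ f x) : ∑ x ∈ s.biUnion t, f x ≤ ∑ a ∈ s, ∑ x ∈ t a, f x := by
  induction s using Finset.induction_on with
  | empty => simp
  | insert a s ha ih =>
    rw [Finset.biUnion_insert, Finset.sum_insert ha]
    refine le_trans ?_ (add_le_add_right ih _)
    rw [← Finset.sum_union_inter]
    exact le_add_of_nonneg_right (Finset.sum_nonneg fun x _ => hf x)

/-! ### Independence: product formulas for weights of matrices. -/

section Weight

variable {R ι κ : Type*} [Fintype R] [Fintype ι] [Fintype κ] [DecidableEq ι] [DecidableEq κ]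
  {w : R → ℝ}

theorem sum_prod_rows_filter (f : (κ → R) → ℝ) (p : ι → (κ → R) → Prop) :
    ∑ A : ι → κ → R with ∀ i, p i (A i), ∏ i, f (A i) =
      ∏ i, ∑ a : κ → R with p i a, f a := by
  rw [Finset.prod_univ_sum]
  congr 1
  ext A
  simp

theorem sum_matWeight_filter (w : R → ℝ) (p : (κ → R) → Prop) :
    ∑ A : Matrix ι κ R with ∀ i, p (A.row i), matWeight w A =
      (∑ a : κ → R with p a, vecWeight w a) ^ Fintype.card ι := by
  refine (sum_prod_rows_filter (vecWeight w) fun _ => p).trans ?_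
  simp

theorem sum_matWeight_filter_transpose (w : R → ℝ) (p : (ι → R) → Prop) :
    ∑ A : Matrix ι κ R with ∀ j, p (A.col j), matWeight w A =
      (∑ a : ι → R with p a, vecWeight w a) ^ Fintype.card κ := by
  rw [← sum_matWeight_filter (ι := κ)]
  refine Finset.sum_bij' (fun A _ => A.transpose) (fun A _ => A.transpose) ?_ ?_ ?_ ?_ ?_ <;>
    simp [matWeight_transpose]

theorem IsWeight.vecWeight_nonneg {R ι : Type*} [Fintype R] [Fintype ι] {w : R → ℝ}
    (hw : IsWeight w) (a : ι → R) : 0 ≤ vecWeight w a :=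
  Finset.prod_nonneg fun _ _ => hw.nonneg _

theorem IsWeight.matWeight_nonneg {R ι κ : Type*} [Fintype R] [Fintype ι] [Fintype κ]
    {w : R → ℝ} (hw : IsWeight w) (A : Matrix ι κ R) : 0 ≤ matWeight w A :=
  Finset.prod_nonneg fun _ _ => hw.vecWeight_nonneg _

theorem IsWeight.sum_vecWeight (hw : IsWeight w) : ∑ a : ι → R, vecWeight w a = 1 := by
  simp only [vecWeight]
  rw [← Fintype.prod_sum]
  simp [hw.sum_eq_one]

theorem IsWeight.sum_matWeight (hw : IsWeight w) : ∑ A : Matrix ι κ R, matWeight w A = 1 := by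
  have := sum_matWeight_filter (ι := ι) w fun _ : κ → R => True
  simpa [hw.sum_vecWeight] using this

end Weight

/-! ### Fourier analysis of a single random vector. -/

section Character

variable {R : Type*} [CommRing R] [Fintype R] {w : R → ℝ}

/-- The Fourier transform of a weight. -/
noncomputable def charSum (w : R → ℝ) (ψ : AddChar R ℂ) : ℂ := ∑ x, (w x : ℂ) * ψ x

/-- A character is flat when it is constant on the support of the weight. -/
def IsFlat (w : R → ℝ) (ψ : AddChar R ℂ) : Prop :=
  ∀ x y, w x ≠ 0 → w y ≠ 0 → ψ x = ψ y

/-- The family `ψ`, as a vector over the `R`-module of characters, is orthogonal to `a`. -/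
def Annihilates {ι : Type*} [Fintype ι] (ψ : ι → AddChar R ℂ) (a : ι → R) : Prop :=
  ∀ r, ∏ i, ψ i (r * a i) = 1

/-- The probability that a random vector is orthogonal to `ψ`. -/
noncomputable def annProb {ι : Type*} [Fintype ι] (w : R → ℝ) (ψ : ι → AddChar R ℂ) : ℝ :=
  ∑ a : ι → R with Annihilates ψ a, vecWeight w a

/-- The number of coordinates of `r • ψ` that are not flat. -/
noncomputable def nonflatCount {ι : Type*} [Fintype ι] (w : R → ℝ) (ψ : ι → AddChar R ℂ)
    (r : R) : ℕ :=
  #{i | ¬ IsFlat w ((ψ i).mulShift r)}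

theorem IsWeight.norm_charSum_le_one (hw : IsWeight w) (ψ : AddChar R ℂ) : ‖charSum w ψ‖ ≤ 1 := by
  refine (norm_sum_le _ _).trans ?_
  simp [abs_of_nonneg (hw.nonneg _), hw.sum_eq_one]

/-- Equality case of the triangle inequality: an average of unit complex numbers has modulus one
only if they agree wherever the weight is positive. -/
theorem IsWeight.isFlat_of_norm_charSum (hw : IsWeight w) {ψ : AddChar R ℂ}
    (h : ‖charSum w ψ‖ = 1) : IsFlat w ψ := by
  set z := charSum w ψ with hz
  have hzz : (starRingEnd ℂ) z * z = 1 := by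
    rw [mul_comm, Complex.mul_conj, Complex.normSq_eq_norm_sq, h]; simp
  have hsum : ∑ x, w x * (1 - ((starRingEnd ℂ) z * ψ x).re) = 0 := by
    have h1 : (starRingEnd ℂ) z * z = ∑ x, (w x : ℂ) * ((starRingEnd ℂ) z * ψ x) := by
      nth_rewrite 2 [hz]
      rw [charSum, Finset.mul_sum]
      exact Finset.sum_congr rfl fun x _ => by ring
    have h2 : (1 : ℝ) = ∑ x, w x * ((starRingEnd ℂ) z * ψ x).re := by
      have := congrArg Complex.re (hzz.symm.trans h1)
      rw [Complex.re_sum] at this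
      simpa only [Complex.re_ofReal_mul, Complex.one_re] using this
    simp only [mul_sub, mul_one, Finset.sum_sub_distrib]
    rw [← h2, hw.sum_eq_one, sub_self]
  have hnorm (x) : ‖(starRingEnd ℂ) z * ψ x‖ = 1 := by simp [h]
  have hle (x) : ((starRingEnd ℂ) z * ψ x).re ≤ 1 := (Complex.re_le_norm _).trans (hnorm x).le
  have hone (x) (hx : w x ≠ 0) : ψ x = z := by
    have h3 := (Finset.sum_eq_zero_iff_of_nonneg fun x _ =>
      mul_nonneg (hw.nonneg x) (sub_nonneg.2 (hle x))).1 hsum x (Finset.mem_univ x)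
    have h4 : ((starRingEnd ℂ) z * ψ x).re = 1 := by
      rcases mul_eq_zero.1 h3 with h3 | h3
      · exact absurd h3 hx
      · linarith
    have h5 : (starRingEnd ℂ) z * ψ x = 1 := by
      have h6 := Complex.normSq_eq_norm_sq ((starRingEnd ℂ) z * ψ x)
      rw [hnorm, Complex.normSq_apply, h4] at h6
      refine Complex.ext h4 ?_
      have : ((starRingEnd ℂ) z * ψ x).im * ((starRingEnd ℂ) z * ψ x).im = 0 := by linarith
      simpa using this
    calc ψ x = ((starRingEnd ℂ) z * z) * ψ x := by rw [hzz, one_mul]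
      _ = z * ((starRingEnd ℂ) z * ψ x) := by ring
      _ = z := by rw [h5, mul_one]
  intro x y hx hy
  rw [hone x hx, hone y hy]

/-- A finite ring has finitely many characters, so the strict inequalities for nonflat characters
have a uniform gap. -/
theorem IsWeight.exists_charSum_bound (hw : IsWeight w) :
    ∃ ρ : ℝ, 0 < ρ ∧ ρ < 1 ∧ ∀ ψ, ¬ IsFlat w ψ → ‖charSum w ψ‖ ≤ ρ := by
  have key : ∀ s : Finset (AddChar R ℂ), ∃ ρ : ℝ, 0 < ρ ∧ ρ < 1 ∧
      ∀ ψ ∈ s, ¬ IsFlat w ψ → ‖charSum w ψ‖ ≤ ρ := by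
    intro s
    induction s using Finset.induction_on with
    | empty => exact ⟨1 / 2, by norm_num, by norm_num, by simp⟩
    | insert φ s _ ih =>
      obtain ⟨ρ, h0, h1, h⟩ := ih
      by_cases hφ : IsFlat w φ
      · refine ⟨ρ, h0, h1, fun ψ hψ hf => ?_⟩
        rcases Finset.mem_insert.1 hψ with rfl | hψ
        · exact absurd hφ hf
        · exact h ψ hψ hf
      · have h2 : ‖charSum w φ‖ < 1 := lt_of_le_of_ne (hw.norm_charSum_le_one φ)
          fun h => hφ (hw.isFlat_of_norm_charSum h)
        refine ⟨max ρ ‖charSum w φ‖, lt_max_of_lt_left h0, max_lt h1 h2, fun ψ hψ hf => ?_⟩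
        rcases Finset.mem_insert.1 hψ with rfl | hψ
        · exact le_max_right _ _
        · exact (h ψ hψ hf).trans (le_max_left _ _)
  obtain ⟨ρ, h0, h1, h⟩ := key Finset.univ
  exact ⟨ρ, h0, h1, fun ψ => h ψ (Finset.mem_univ ψ)⟩

variable {ι : Type*} [Fintype ι] {ρ : ℝ}

theorem sum_vecWeight_mul_prod [DecidableEq ι] (w : R → ℝ) (ψ : ι → AddChar R ℂ) :
    ∑ a : ι → R, (vecWeight w a : ℂ) * ∏ i, ψ i (a i) = ∏ i, charSum w (ψ i) := by
  simp only [charSum, vecWeight]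
  rw [Fintype.prod_sum]
  push_cast
  simp only [Finset.prod_mul_distrib]

theorem IsWeight.norm_prod_charSum_le (hw : IsWeight w)
    (hρ : ∀ ψ, ¬ IsFlat w ψ → ‖charSum w ψ‖ ≤ ρ) (ψ : ι → AddChar R ℂ) (r : R) :
    ‖∏ i, charSum w ((ψ i).mulShift r)‖ ≤ ρ ^ nonflatCount w ψ r := by
  rw [norm_prod, nonflatCount, ← Finset.prod_const, Finset.prod_filter]
  refine Finset.prod_le_prod (fun _ _ => norm_nonneg _) fun i _ => ?_
  split_ifs with h
  · exact hw.norm_charSum_le_one _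
  · exact hρ _ h

/-- For fixed `a`, the map `r ↦ ∏ i, ψ i (r * a i)` is an additive character of `R`. Its sum over
`r` is `|R|` when it is trivial, that is when `ψ` annihilates `a`, and zero otherwise. -/
theorem card_mul_annProb (w : R → ℝ) (ψ : ι → AddChar R ℂ) :
    (Fintype.card R : ℂ) * annProb w ψ = ∑ r, ∏ i, charSum w ((ψ i).mulShift r) := by
  simp only [← sum_vecWeight_mul_prod]
  rw [Finset.sum_comm, annProb]
  push_cast
  rw [Finset.sum_filter, Finset.mul_sum]
  refine Finset.sum_congr rfl fun a _ => ?_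
  rw [← Finset.mul_sum]
  let θ : AddChar R ℂ := ∏ i, (ψ i).mulShift (a i)
  have hθ (r : R) : θ r = ∏ i, ψ i (r * a i) := by
    simp only [θ, AddChar.prod_apply, AddChar.mulShift_apply, mul_comm r]
  have h1 : ∑ r, ∏ i, (ψ i).mulShift r (a i) = ∑ r, θ r :=
    Finset.sum_congr rfl fun r _ => by simp only [hθ, AddChar.mulShift_apply]
  rw [h1, AddChar.sum_eq_ite]
  have h2 : θ = 0 ↔ Annihilates ψ a := by
    rw [AddChar.eq_zero_iff]
    simp only [hθ, Annihilates]
  by_cases h : Annihilates ψ a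
  · simp [h2.2 h, h, mul_comm]
  · simp [mt h2.1 h, h]

theorem IsWeight.card_mul_annProb_le (hw : IsWeight w)
    (hρ : ∀ ψ, ¬ IsFlat w ψ → ‖charSum w ψ‖ ≤ ρ) (ψ : ι → AddChar R ℂ) :
    (Fintype.card R : ℝ) * annProb w ψ ≤ ∑ r, ρ ^ nonflatCount w ψ r := by
  have h0 : 0 ≤ annProb w ψ := Finset.sum_nonneg fun a _ => hw.vecWeight_nonneg a
  have h1 : (Fintype.card R : ℝ) * annProb w ψ = ‖(Fintype.card R : ℂ) * annProb w ψ‖ := by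
    rw [norm_mul, Complex.norm_natCast, Complex.norm_real, Real.norm_of_nonneg h0]
  rw [h1, card_mul_annProb]
  exact (norm_sum_le _ _).trans (Finset.sum_le_sum fun r _ => hw.norm_prod_charSum_le hρ ψ r)

theorem IsWeight.annProb_nonneg (hw : IsWeight w) (ψ : ι → AddChar R ℂ) : 0 ≤ annProb w ψ :=
  Finset.sum_nonneg fun a _ => hw.vecWeight_nonneg a

theorem IsWeight.annProb_le_one (hw : IsWeight w) (ψ : ι → AddChar R ℂ) : annProb w ψ ≤ 1 := by
  rw [← hw.sum_vecWeight (ι := ι)]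
  exact Finset.sum_le_sum_of_subset_of_nonneg (Finset.filter_subset _ _)
    fun a _ _ => hw.vecWeight_nonneg a

end Character

/-- Nondegeneracy of a weight: it charges two points whose difference is a unit, and it does not
live on an affine image of a proper subring. -/
structure IsSpreadWeight {R : Type*} [CommRing R] [Fintype R] (w : R → ℝ) : Prop extends
    IsWeight w where
  exists_unit : ∃ x y, w x ≠ 0 ∧ w y ≠ 0 ∧ IsUnit (x - y)
  eq_top : ∀ (S : Subring R) (a : R) (c : Rˣ),
    (∀ x, w x ≠ 0 → ∃ s ∈ S, x = a + c * s) → S = ⊤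

/-! ### Counting mostly flat families; where the subring hypothesis enters. -/

section Span

variable {R : Type*} [CommRing R] [Fintype R] {w : R → ℝ}

/-- The additive group generated by the products of elements of `T` with differences of points
charged by `w`. -/
def diffSpan (w : R → ℝ) (T : Finset R) : AddSubgroup R :=
  AddSubgroup.closure {z | ∃ r ∈ T, ∃ x y, w x ≠ 0 ∧ w y ≠ 0 ∧ z = r * (x - y)}

/-- The characters that are trivial on `K`. -/
noncomputable def annChars (K : AddSubgroup R) : Finset (AddChar R ℂ) := {ψ | ∀ z ∈ K, ψ z = 1}

theorem mul_sub_mem_diffSpan {R : Type*} [CommRing R] {w : R → ℝ} {T : Finset R} {r x y : R} (hr : r ∈ T) (hx : w x ≠ 0)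
    (hy : w y ≠ 0) : r * (x - y) ∈ diffSpan w T :=
  AddSubgroup.subset_closure ⟨r, hr, x, y, hx, hy, rfl⟩

/-- Sum `ψ z` over `z ∈ K` and all `ψ`, in both orders: only `z = 0` contributes in one, only
characters trivial on `K` in the other. -/
theorem card_annChars_mul_le (K : AddSubgroup R) :
    #(annChars K) * Nat.card K ≤ Fintype.card R := by
  have h1 : ∑ z : K, ∑ ψ : AddChar R ℂ, ψ z = (Fintype.card R : ℂ) := by
    rw [Finset.sum_eq_single 0]
    · simp [AddChar.card_eq]
    · intro z _ hz
      exact AddChar.sum_apply_eq_zero_iff_ne_zero.2 fun h => hz (Subtype.ext h)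
    · simp
  have h2 : ∑ z : K, ∑ ψ : AddChar R ℂ, ψ z = ((#(annChars K) * Nat.card K : ℕ) : ℂ) := by
    rw [Finset.sum_comm, annChars, Finset.card_filter]
    push_cast
    rw [Finset.sum_mul]
    refine Finset.sum_congr rfl fun ψ _ => ?_
    have h3 : ∑ z : K, ψ z = ∑ z : K, ψ.compAddMonoidHom K.subtype z := by simp
    rw [h3, AddChar.sum_eq_ite, Nat.card_eq_fintype_card]
    have h4 : ψ.compAddMonoidHom K.subtype = 0 ↔ ∀ z ∈ K, ψ z = 1 := by
      rw [AddChar.eq_zero_iff]; simp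
    by_cases h : ∀ z ∈ K, ψ z = 1
    · rw [if_pos (h4.2 h), if_pos h, one_mul]
    · rw [if_neg (mt h4.1 h), if_neg h, zero_mul]
  exact (Nat.cast_injective (h2.symm.trans h1)).le

theorem IsSpreadWeight.diffSpan_univ (hw : IsSpreadWeight w) :
    diffSpan w Finset.univ = ⊤ := by
  obtain ⟨x, y, hx, hy, u, hu⟩ := hw.exists_unit
  refine (AddSubgroup.eq_top_iff' _).2 fun z => ?_
  have := mul_sub_mem_diffSpan (Finset.mem_univ (z * ↑u⁻¹)) hx hy
  rwa [← hu, mul_assoc, Units.inv_mul, mul_one] at this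

/-- If `u = x - y` is a unit difference of charged points, `T * u` sits inside `diffSpan w T`. When
the cardinalities agree, `T * u` is a group, so the multipliers preserving `T` form a subring. That
subring, scaled by `u` and translated by `y`, contains the support, hence is all of `R`; then `1 ∈
T` gives `T = R`. -/
theorem IsSpreadWeight.eq_univ_or_card_lt (hw : IsSpreadWeight w) {T : Finset R}
    (h1 : (1 : R) ∈ T) : T = Finset.univ ∨ #T + 1 ≤ Nat.card (diffSpan w T) := by
  obtain ⟨x, y, hx, hy, u, hu⟩ := hw.exists_unit
  have hinj : Function.Injective fun t : R => t * (u : R) := fun a b h => by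
    simpa using h
  have hsub : (T.image fun t => t * (u : R)) ⊆ (diffSpan w T : Set R).toFinset := by
    intro z hz
    obtain ⟨t, ht, rfl⟩ := Finset.mem_image.1 hz
    rw [Set.mem_toFinset]
    simpa [hu] using mul_sub_mem_diffSpan ht hx hy
  have hcard : #(diffSpan w T : Set R).toFinset = Nat.card (diffSpan w T) := by
    rw [Set.toFinset_card, Nat.card_eq_fintype_card]; rfl
  have hle : #T ≤ Nat.card (diffSpan w T) := by
    rw [← hcard, ← Finset.card_image_of_injective T hinj]
    exact Finset.card_le_card hsub
  rcases hle.lt_or_eq with h | h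
  · exact Or.inr h
  left
  have heq : (T.image fun t => t * (u : R)) = (diffSpan w T : Set R).toFinset :=
    Finset.eq_of_subset_of_card_le hsub
      (by rw [hcard, Finset.card_image_of_injective T hinj, h])
  have hmem (z : R) : z * u ∈ diffSpan w T ↔ z ∈ T := by
    rw [← SetLike.mem_coe, ← Set.mem_toFinset, ← heq, Finset.mem_image]
    exact ⟨fun ⟨t, ht, htz⟩ => hinj htz ▸ ht, fun hz => ⟨z, hz, rfl⟩⟩
  -- Additive closure of `S` uses that `T` is an additive group, which `hmem` supplies.
  let S : Subring R :=
    { carrier := {s | ∀ t ∈ T, s * t ∈ T}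
      mul_mem' := fun {a b} ha hb t ht => by
        rw [mul_assoc]; exact ha _ (hb t ht)
      one_mem' := fun t ht => by rwa [one_mul]
      add_mem' := fun {a b} ha hb t ht => by
        rw [← hmem, add_mul, add_mul]
        exact add_mem ((hmem _).2 (ha t ht)) ((hmem _).2 (hb t ht))
      zero_mem' := fun t _ => by
        rw [← hmem, zero_mul, zero_mul]; exact zero_mem _
      neg_mem' := fun {a} ha t ht => by
        rw [← hmem, neg_mul, neg_mul]
        exact neg_mem ((hmem _).2 (ha t ht)) }
  have hS : S = ⊤ := by
    refine hw.eq_top S y u fun z hz => ⟨↑u⁻¹ * (z - y), fun t ht => ?_, ?_⟩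
    · rw [← hmem]
      have : ↑u⁻¹ * (z - y) * t * ↑u = t * (z - y) * (↑u⁻¹ * ↑u) := by ring
      rw [this, Units.inv_mul, mul_one]
      exact mul_sub_mem_diffSpan ht hz hy
    · rw [← mul_assoc, Units.mul_inv, one_mul]; ring
  refine Finset.eq_univ_iff_forall.2 fun z => ?_
  have hz : z ∈ S := hS ▸ Subring.mem_top z
  simpa using hz 1 h1

variable {ι : Type*} [Fintype ι]

/-- Links the level set `T` to a counting problem: flatness of all shifts by `T` is triviality on
one subgroup. -/
theorem isFlat_mulShift_of_mem_annChars {T : Finset R} {ψ : AddChar R ℂ} :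
    ψ ∈ annChars (diffSpan w T) ↔ ∀ r ∈ T, IsFlat w (ψ.mulShift r) := by
  have hiff (r x y : R) : ψ.mulShift r x = ψ.mulShift r y ↔ ψ (r * (x - y)) = 1 := by
    rw [mul_sub, AddChar.map_sub_eq_div, AddChar.mulShift_apply, AddChar.mulShift_apply,
      div_eq_one_iff_eq (ψ.val_isUnit _).ne_zero]
  constructor
  · intro h r hr x y hx hy
    rw [hiff]
    exact (Finset.mem_filter.1 h).2 _ (mul_sub_mem_diffSpan hr hx hy)
  · intro h
    refine Finset.mem_filter.2 ⟨Finset.mem_univ _, fun z hz => ?_⟩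
    induction hz using AddSubgroup.closure_induction with
    | mem z hz =>
      obtain ⟨r, hr, x, y, hx, hy, rfl⟩ := hz
      exact (hiff r x y).1 (h r hr x y hx hy)
    | zero => simp
    | add a b _ _ ha hb => rw [AddChar.map_add_eq_mul, ha, hb, one_mul]
    | neg a _ ha => rw [AddChar.map_neg_eq_inv, ha, inv_one]

theorem card_notMem_annChars_le {T : Finset R} {L : ℕ} {ψ : ι → AddChar R ℂ}
    (h : ∀ r ∈ T, nonflatCount w ψ r ≤ L) :
    #{i | ψ i ∉ annChars (diffSpan w T)} ≤ #T * L := by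
  have hsub : ({i | ψ i ∉ annChars (diffSpan w T)} : Finset ι) ⊆
      T.biUnion fun r => {i | ¬ IsFlat w ((ψ i).mulShift r)} := by
    intro i hi
    have hi' := (Finset.mem_filter.1 hi).2
    rw [isFlat_mulShift_of_mem_annChars] at hi'
    push Not at hi'
    obtain ⟨r, hr, hf⟩ := hi'
    exact Finset.mem_biUnion.2 ⟨r, hr, by simpa using hf⟩
  exact (Finset.card_le_card hsub).trans (Finset.card_biUnion_le_card_mul _ _ _ h)

/-- A weighted count of the maps that take few values outside `D`. -/
theorem card_filter_few_notMem_le {X : Type*} [Fintype X] (D : Finset X) (B : ℕ) {t : ℝ}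
    (h0 : 0 < t) (h1 : t ≤ 1) :
    (#{ψ : ι → X | #{i | ψ i ∉ D} ≤ B} : ℝ) ≤
      t⁻¹ ^ B * (#D + t * Fintype.card X) ^ Fintype.card ι := by
  have hsum : ∑ ψ : ι → X, t ^ #{i | ψ i ∉ D} = (∑ x : X, if x ∉ D then t else 1) ^
      Fintype.card ι := by
    rw [← Finset.card_univ, ← Finset.prod_const, Fintype.prod_sum]
    refine Finset.sum_congr rfl fun ψ _ => ?_
    rw [← Finset.prod_const, Finset.prod_filter]
  have hle : ∑ x : X, (if x ∉ D then t else 1) ≤ #D + t * Fintype.card X := by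
    have h2 : ∀ x : X, (if x ∉ D then t else 1) ≤ (if x ∈ D then 1 else 0) + t := by
      intro x
      by_cases hx : x ∈ D <;> simp [hx, h0.le]
    refine (Finset.sum_le_sum fun x _ => h2 x).trans ?_
    rw [Finset.sum_add_distrib]
    simp [mul_comm]
  calc (#{ψ : ι → X | #{i | ψ i ∉ D} ≤ B} : ℝ)
      = ∑ ψ : ι → X with #{i | ψ i ∉ D} ≤ B, 1 := by simp
    -- Exponential Markov inequality: as `t ≤ 1`, every counted map has weight at least one.
    _ ≤ ∑ ψ : ι → X with #{i | ψ i ∉ D} ≤ B, t⁻¹ ^ B * t ^ #{i | ψ i ∉ D} := by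
        refine Finset.sum_le_sum fun ψ hψ => ?_
        rw [inv_pow, ← div_eq_inv_mul, one_le_div (by positivity)]
        exact pow_le_pow_of_le_one h0.le h1 (Finset.mem_filter.1 hψ).2
    _ ≤ ∑ ψ : ι → X, t⁻¹ ^ B * t ^ #{i | ψ i ∉ D} :=
        Finset.sum_le_sum_of_subset_of_nonneg (Finset.filter_subset _ _)
          fun _ _ _ => by positivity
    _ = t⁻¹ ^ B * (∑ x : X, if x ∉ D then t else 1) ^ Fintype.card ι := by
        rw [← Finset.mul_sum, hsum]
    _ ≤ _ := by
        refine mul_le_mul_of_nonneg_left (pow_le_pow_left₀ ?_ hle _) (by positivity)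
        exact Finset.sum_nonneg fun x _ => by split_ifs <;> positivity

end Span

/-! ### Asymptotics for the flatness threshold `m.sqrt`. -/

/-- The threshold is small enough that the combinatorial loss `C ^ m.sqrt` is beaten by exponential
decay. -/
theorem tendsto_pow_sqrt_mul_pow (C : ℝ) {γ : ℝ} (hC : 0 ≤ C) (h0 : 0 ≤ γ) (h1 : γ < 1) :
    Filter.Tendsto (fun m : ℕ => C ^ m.sqrt * γ ^ m) Filter.atTop (nhds 0) := by
  have hs : Filter.Tendsto Nat.sqrt Filter.atTop Filter.atTop :=
    Filter.tendsto_atTop_atTop.2 fun b => ⟨b * b, fun a ha => Nat.le_sqrt.2 ha⟩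
  have hlim : Filter.Tendsto (fun L : ℕ => C * γ ^ L) Filter.atTop (nhds 0) := by
    simpa using (tendsto_pow_atTop_nhds_zero_of_lt_one h0 h1).const_mul C
  have hev : ∀ᶠ m : ℕ in Filter.atTop, C * γ ^ m.sqrt ≤ 1 / 2 :=
    hs.eventually (hlim.eventually_le_const (by norm_num))
  have hhalf : Filter.Tendsto (fun m : ℕ => (1 / 2 : ℝ) ^ m.sqrt) Filter.atTop (nhds 0) :=
    (tendsto_pow_atTop_nhds_zero_of_lt_one (by norm_num) (by norm_num)).comp hs
  refine squeeze_zero' (.of_forall fun m => by positivity) ?_ hhalf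
  filter_upwards [hev] with m hm
  calc C ^ m.sqrt * γ ^ m ≤ C ^ m.sqrt * γ ^ (m.sqrt * m.sqrt) :=
        mul_le_mul_of_nonneg_left (pow_le_pow_of_le_one h0 h1.le (Nat.sqrt_le m)) (by positivity)
    _ = (C * γ ^ m.sqrt) ^ m.sqrt := by rw [mul_pow, pow_mul]
    _ ≤ _ := pow_le_pow_left₀ (by positivity) hm _

/-- The threshold is also large enough that Fourier errors `ρ ^ m.sqrt` survive multiplication by
`m`, as needed when an error is raised to the power `m`. -/
theorem tendsto_mul_pow_sqrt {ρ : ℝ} (h0 : 0 ≤ ρ) (h1 : ρ < 1) :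
    Filter.Tendsto (fun m : ℕ => (m : ℝ) * ρ ^ m.sqrt) Filter.atTop (nhds 0) := by
  have hs : Filter.Tendsto Nat.sqrt Filter.atTop Filter.atTop :=
    Filter.tendsto_atTop_atTop.2 fun b => ⟨b * b, fun a ha => Nat.le_sqrt.2 ha⟩
  have hlim : Filter.Tendsto (fun L : ℕ => 4 * ((L : ℝ) ^ 2 * ρ ^ L)) Filter.atTop (nhds 0) := by
    simpa using (tendsto_pow_const_mul_const_pow_of_abs_lt_one 2
      (abs_lt.2 ⟨by linarith, h1⟩)).const_mul 4
  refine squeeze_zero' (.of_forall fun m => by positivity) ?_ (hlim.comp hs)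
  filter_upwards [Filter.eventually_ge_atTop 1] with m hm
  have h2 : 1 ≤ m.sqrt := Nat.le_sqrt.2 (by omega)
  have h3 : m < (m.sqrt + 1) * (m.sqrt + 1) := Nat.lt_succ_sqrt m
  have h4 : m ≤ 4 * m.sqrt ^ 2 := by nlinarith
  have h5 : (m : ℝ) ≤ 4 * (m.sqrt : ℝ) ^ 2 := by exact_mod_cast h4
  calc (m : ℝ) * ρ ^ m.sqrt ≤ 4 * (m.sqrt : ℝ) ^ 2 * ρ ^ m.sqrt :=
        mul_le_mul_of_nonneg_right h5 (by positivity)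
    _ = _ := by simp only [Function.comp]; ring

/-! ### First moment bound for mostly flat annihilating families. -/

section Key

variable {R : Type*} [CommRing R] [Fintype R] {w : R → ℝ} {ρ : ℝ} {ι : Type*} [Fintype ι]

theorem IsSpreadWeight.annProb_le (hw : IsSpreadWeight w) (h0 : 0 ≤ ρ) (h1 : ρ ≤ 1)
    (hρ : ∀ ψ, ¬ IsFlat w ψ → ‖charSum w ψ‖ ≤ ρ) {ψ : ι → AddChar R ℂ} (hψ : ∃ i, ψ i ≠ 0) :
    annProb w ψ ≤ 1 - (1 - ρ) / Fintype.card R := by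
  have hN : (0 : ℝ) < Fintype.card R := by exact_mod_cast Fintype.card_pos
  obtain ⟨i, hi⟩ := hψ
  obtain ⟨z, hz⟩ := AddChar.ne_zero_iff.1 hi
  obtain ⟨x, y, hx, hy, u, hu⟩ := hw.exists_unit
  -- The shift by `z * u⁻¹` turns the charged difference `x - y = u` into `z`, where `ψ i` is not
  -- one; this single shift saves `1 - ρ` in the sum over `r`.
  have hflat : ¬ IsFlat w ((ψ i).mulShift (z * ↑u⁻¹)) := by
    intro h
    have h2 := h x y hx hy
    have h3 : z = z * ↑u⁻¹ * x - z * ↑u⁻¹ * y := by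
      rw [← mul_sub, ← hu, mul_assoc, Units.inv_mul, mul_one]
    rw [AddChar.mulShift_apply, AddChar.mulShift_apply] at h2
    rw [h3, AddChar.map_sub_eq_div, h2, div_self ((ψ i).val_isUnit _).ne_zero] at hz
    exact hz rfl
  have hcount : 1 ≤ nonflatCount w ψ (z * ↑u⁻¹) :=
    Finset.card_pos.2 ⟨i, by simpa using hflat⟩
  have h4 := hw.card_mul_annProb_le hρ ψ
  have h5 : ∑ r, ρ ^ nonflatCount w ψ r ≤ ∑ r, (1 - if r = z * ↑u⁻¹ then 1 - ρ else 0) := by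
    refine Finset.sum_le_sum fun r _ => ?_
    split_ifs with hr
    · rw [hr, sub_sub_cancel]
      exact pow_le_of_le_one h0 h1 (by omega)
    · rw [sub_zero]
      exact pow_le_one₀ h0 h1
  rw [Finset.sum_sub_distrib] at h5
  simp only [Finset.sum_const, Finset.card_univ, nsmul_eq_mul, mul_one, Finset.sum_ite_eq',
    Finset.mem_univ, if_true] at h5
  rw [← mul_le_mul_iff_of_pos_left hN, mul_sub, mul_one, mul_div_cancel₀ _ hN.ne']
  exact h4.trans h5

theorem IsWeight.annProb_le_of_lt_nonflatCount (hw : IsWeight w) (h0 : 0 ≤ ρ) (h1 : ρ ≤ 1)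
    (hρ : ∀ ψ, ¬ IsFlat w ψ → ‖charSum w ψ‖ ≤ ρ) {ψ : ι → AddChar R ℂ} {T : Finset R} {L : ℕ}
    (hT : ∀ r ∉ T, L < nonflatCount w ψ r) :
    Fintype.card R * annProb w ψ ≤ #T + Fintype.card R * ρ ^ L := by
  refine (hw.card_mul_annProb_le hρ ψ).trans ?_
  have h2 : ∀ r, ρ ^ nonflatCount w ψ r ≤ (if r ∈ T then 1 else 0) + ρ ^ L := by
    intro r
    split_ifs with hr
    · exact (pow_le_one₀ h0 h1).trans (le_add_of_nonneg_right (by positivity))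
    · rw [zero_add]
      exact pow_le_pow_of_le_one h0 h1 (hT r hr).le
  refine (Finset.sum_le_sum fun r _ => h2 r).trans ?_
  rw [Finset.sum_add_distrib]
  simp

/-- Families with level set `T` have at most `|T| * L` coordinates outside `D`, so they number at
most `t⁻¹ ^ (|R| * L) * c ^ (m + k)` with `c = |D| + t * |R|`. Each has `annProb` at most `(1 - δ /
2) / c`, so the powers `c ^ m` cancel and exponential decay remains. -/
theorem IsSpreadWeight.sum_annProb_pow_le_of_levelSet (hw : IsSpreadWeight w) (h0 : 0 ≤ ρ)
    (h1 : ρ < 1) (hρ : ∀ ψ, ¬ IsFlat w ψ → ‖charSum w ψ‖ ≤ ρ) {t δ : ℝ} {L m k : ℕ}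
    (hδ : δ = (1 - ρ) / Fintype.card R) (ht0 : 0 < t) (ht : t * Fintype.card R ≤ δ / 4)
    (hL : Fintype.card R * ρ ^ L ≤ δ / 4) (hι : Fintype.card ι = m + k) {T : Finset R}
    (hT : 1 ∈ T) :
    ∑ ψ : ι → AddChar R ℂ with (∃ i, ψ i ≠ 0) ∧ ∀ r, r ∈ T ↔ nonflatCount w ψ r ≤ L,
      annProb w ψ ^ m ≤
      (t⁻¹ ^ Fintype.card R) ^ L * (1 - δ / 2) ^ m * (2 * Fintype.card R) ^ k := by
  set N : ℝ := (Fintype.card R : ℝ) with hN'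
  have hN : (1 : ℝ) ≤ N := Nat.one_le_cast.2 Fintype.card_pos
  have hδN : δ ≤ 1 / N := by rw [hδ]; gcongr; linarith
  have hδ1 : δ ≤ 1 := hδN.trans ((div_le_one (by linarith)).2 hN)
  have ht1 : t ≤ 1 := by nlinarith
  set D := annChars (diffSpan w T) with hD
  have hDN : (#D : ℝ) ≤ N := by
    have := Finset.card_le_univ D
    rw [AddChar.card_eq] at this
    exact Nat.cast_le.2 this
  set c : ℝ := #D + t * N with hc
  have hc0 : 0 < c := by positivity
  have hc1 : c ≤ 2 * N := by nlinarith
  have hcard : (#{ψ : ι → AddChar R ℂ | (∃ i, ψ i ≠ 0) ∧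
      ∀ r, r ∈ T ↔ nonflatCount w ψ r ≤ L} : ℝ) ≤ (t⁻¹ ^ Fintype.card R) ^ L * c ^ (m + k) := by
    rw [← pow_mul, hc, hN', ← AddChar.card_eq (α := R), ← hι]
    refine le_trans ?_ (card_filter_few_notMem_le D _ ht0 ht1)
    refine Nat.cast_le.2 (Finset.card_le_card fun ψ hψ => ?_)
    simp only [Finset.mem_filter, Finset.mem_univ, true_and] at hψ ⊢
    refine (card_notMem_annChars_le fun r hr => (hψ.2 r).1 hr).trans ?_
    rw [AddChar.card_eq]
    exact Nat.mul_le_mul_right _ (Finset.card_le_univ _)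
  have hterm : ∀ ψ : ι → AddChar R ℂ, (∃ i, ψ i ≠ 0) →
      (∀ r, r ∈ T ↔ nonflatCount w ψ r ≤ L) → annProb w ψ ≤ (1 - δ / 2) / c := by
    intro ψ hψ hψT
    rw [le_div_iff₀ hc0]
    have hq0 := hw.annProb_nonneg ψ
    have hq1 := hw.annProb_le_one ψ
    -- If `T` is everything, `D` is trivial and the saving `δ` comes from `annProb_le`. Otherwise
    -- `|D| * (|T| + 1) ≤ |R|` saves `1 / |R| ≥ δ`. The extra `δ / 4` covers the Fourier error.
    have hDq : #D * annProb w ψ ≤ 1 - δ + δ / 4 := by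
      rcases hw.eq_univ_or_card_lt hT with h | h
      · have hD1 : #D ≤ 1 := by
          refine Finset.card_le_one.2 fun a ha b hb => ?_
          rw [hD, h, hw.diffSpan_univ] at ha hb
          ext z
          rw [(Finset.mem_filter.1 ha).2 z trivial, (Finset.mem_filter.1 hb).2 z trivial]
        have hD1' : (#D : ℝ) ≤ 1 := by exact_mod_cast hD1
        have h2 := hw.annProb_le h0 h1.le hρ hψ
        rw [← hN', ← hδ] at h2
        have hδ0 : 0 ≤ δ := by rw [hδ]; exact div_nonneg (by linarith) (by linarith)
        nlinarith
      · have h2 : #D * (#T + 1) ≤ Fintype.card R :=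
          (Nat.mul_le_mul_left _ h).trans (card_annChars_mul_le _)
        have h3 : (#D : ℝ) * #T ≤ N - 1 := by
          have h4 : #D * #T + 1 ≤ Fintype.card R := by
            rcases Nat.eq_zero_or_pos #D with h5 | h5
            · rw [h5, zero_mul]
              exact Fintype.card_pos
            · nlinarith
          rw [le_sub_iff_add_le]
          have h5 := Nat.cast_le (α := ℝ).2 h4
          rwa [Nat.cast_add, Nat.cast_mul, Nat.cast_one] at h5
        have h5 := hw.annProb_le_of_lt_nonflatCount h0 h1.le hρ (ψ := ψ) (T := T) (L := L)
          fun r hr => not_le.1 (mt (hψT r).2 hr)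
        rw [← hN'] at h5
        have h6 : N * (#D * annProb w ψ) ≤ N * (1 - 1 / N + δ / 4) := by
          calc N * (#D * annProb w ψ) = #D * (N * annProb w ψ) := by ring
            _ ≤ #D * (#T + N * ρ ^ L) := by gcongr
            _ = #D * #T + #D * (N * ρ ^ L) := by ring
            _ ≤ (N - 1) + N * (δ / 4) := by gcongr
            _ = _ := by field_simp
        have h7 := le_of_mul_le_mul_left h6 (by linarith)
        linarith
    have htq : t * N * annProb w ψ ≤ δ / 4 := by
      have : 0 ≤ t * N := by positivity
      nlinarith
    rw [hc]
    nlinarith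
  calc _ ≤ ∑ ψ : ι → AddChar R ℂ with (∃ i, ψ i ≠ 0) ∧ ∀ r, r ∈ T ↔ nonflatCount w ψ r ≤ L,
        ((1 - δ / 2) / c) ^ m := by
        refine Finset.sum_le_sum fun ψ hψ => ?_
        obtain ⟨ha, hb⟩ := (Finset.mem_filter.1 hψ).2
        exact pow_le_pow_left₀ (hw.annProb_nonneg ψ) (hterm ψ ha hb) _
    _ = #{ψ : ι → AddChar R ℂ | (∃ i, ψ i ≠ 0) ∧ ∀ r, r ∈ T ↔ nonflatCount w ψ r ≤ L} *
        ((1 - δ / 2) / c) ^ m := by rw [Finset.sum_const, nsmul_eq_mul]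
    _ ≤ ((t⁻¹ ^ Fintype.card R) ^ L * c ^ (m + k)) * ((1 - δ / 2) / c) ^ m :=
        mul_le_mul_of_nonneg_right hcard
          (pow_nonneg (div_nonneg (by linarith) hc0.le) _)
    _ = (t⁻¹ ^ Fintype.card R) ^ L * (1 - δ / 2) ^ m * c ^ k := by
        rw [div_pow, pow_add]; field_simp
    _ ≤ _ := by
        refine mul_le_mul_of_nonneg_left (pow_le_pow_left₀ hc0.le hc1 _) ?_
        exact mul_nonneg (by positivity) (pow_nonneg (by linarith) _)

/-- The expected number of nonzero, mostly flat families orthogonal to `m` random vectors of length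
`m + k` tends to zero. -/
theorem IsSpreadWeight.eventually_sum_annProb_pow_le (hw : IsSpreadWeight w) (h0 : 0 ≤ ρ)
    (h1 : ρ < 1) (hρ : ∀ ψ, ¬ IsFlat w ψ → ‖charSum w ψ‖ ≤ ρ) (k : ℕ) {ε : ℝ} (hε : 0 < ε) :
    ∀ᶠ m : ℕ in Filter.atTop, ∀ (ι : Type) [Fintype ι], Fintype.card ι = m + k →
      ∑ ψ : ι → AddChar R ℂ with (∃ i, ψ i ≠ 0) ∧ nonflatCount w ψ 1 ≤ m.sqrt,
        annProb w ψ ^ m ≤ ε := by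
  set N : ℝ := (Fintype.card R : ℝ) with hN'
  have hN : (1 : ℝ) ≤ N := Nat.one_le_cast.2 Fintype.card_pos
  obtain ⟨δ, hδ⟩ : ∃ δ, δ = (1 - ρ) / N := ⟨_, rfl⟩
  have hδ0 : 0 < δ := by rw [hδ]; exact div_pos (by linarith) (by linarith)
  have hδ1 : δ ≤ 1 := by rw [hδ, div_le_one (by linarith)]; linarith
  obtain ⟨t, ht⟩ : ∃ t, t = δ / 4 / N := ⟨_, rfl⟩
  have ht0 : 0 < t := by rw [ht]; positivity
  have ht1 : t * N ≤ δ / 4 := by rw [ht, div_mul_cancel₀ _ (by linarith)]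
  have hs : Filter.Tendsto Nat.sqrt Filter.atTop Filter.atTop :=
    Filter.tendsto_atTop_atTop.2 fun b => ⟨b * b, fun a ha => Nat.le_sqrt.2 ha⟩
  have hL : ∀ᶠ m : ℕ in Filter.atTop, N * ρ ^ m.sqrt ≤ δ / 4 := by
    have : Filter.Tendsto (fun L : ℕ => N * ρ ^ L) Filter.atTop (nhds 0) := by
      simpa using (tendsto_pow_atTop_nhds_zero_of_lt_one h0 h1).const_mul N
    exact hs.eventually (this.eventually_le_const (by positivity))
  have hlim : Filter.Tendsto (fun m : ℕ => #(Finset.univ : Finset (Finset R)) *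
      ((t⁻¹ ^ Fintype.card R) ^ m.sqrt * (1 - δ / 2) ^ m * (2 * N) ^ k))
      Filter.atTop (nhds 0) := by
    have := ((tendsto_pow_sqrt_mul_pow (t⁻¹ ^ Fintype.card R) (γ := 1 - δ / 2) (by positivity)
      (by linarith) (by linarith)).mul_const ((2 * N) ^ k)).const_mul
        (#(Finset.univ : Finset (Finset R)) : ℝ)
    simpa using this
  filter_upwards [hL, hlim.eventually_le_const hε] with m hm1 hm2 ι _ hι
  refine le_trans ?_ hm2
  -- Sort the families by level set; the threshold at `r = 1` says exactly that `1 ∈ T`, and the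
  -- number of possible `T` does not depend on `m`.
  have hsub : ({ψ : ι → AddChar R ℂ | (∃ i, ψ i ≠ 0) ∧ nonflatCount w ψ 1 ≤ m.sqrt} :
      Finset (ι → AddChar R ℂ)) ⊆
      ({T : Finset R | 1 ∈ T} : Finset (Finset R)).biUnion fun T =>
        {ψ | (∃ i, ψ i ≠ 0) ∧ ∀ r, r ∈ T ↔ nonflatCount w ψ r ≤ m.sqrt} := by
    intro ψ hψ
    obtain ⟨ha, hb⟩ := (Finset.mem_filter.1 hψ).2
    refine Finset.mem_biUnion.2 ⟨Finset.univ.filter fun r => nonflatCount w ψ r ≤ m.sqrt,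
      by simpa using hb, ?_⟩
    simpa using ha
  refine (Finset.sum_le_sum_of_subset_of_nonneg hsub fun ψ _ _ =>
    pow_nonneg (hw.annProb_nonneg ψ) _).trans ?_
  refine (sum_biUnion_le_sum _ _ fun ψ : ι → AddChar R ℂ => pow_nonneg (hw.annProb_nonneg ψ) _).trans ?_
  have hc : 0 ≤ (t⁻¹ ^ Fintype.card R) ^ m.sqrt * (1 - δ / 2) ^ m * (2 * N) ^ k :=
    mul_nonneg (mul_nonneg (by positivity) (pow_nonneg (by linarith) _)) (by positivity)
  have hT (T : Finset R) (hT : 1 ∈ T) :=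
    hw.sum_annProb_pow_le_of_levelSet (ι := ι) h0 h1 hρ hδ ht0 ht1 hm1 hι hT
  refine (Finset.sum_le_card_nsmul _ _ _ fun T h => hT T (Finset.mem_filter.1 h).2).trans ?_
  rw [nsmul_eq_mul]
  exact mul_le_mul_of_nonneg_right (Nat.cast_le.2 (Finset.card_le_univ _)) hc

end Key

/-! ### Probability that `A` degenerates modulo the maximal ideal. -/

section Rank

variable {R : Type*} [CommRing R] [Fintype R] {w : R → ℝ} {ρ : ℝ}

theorem annihilates_mulShift {R ι : Type*} [CommRing R] [Fintype ι] (ψ : ι → AddChar R ℂ) (u : Rˣ) (a : ι → R) :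
    Annihilates (fun i => (ψ i).mulShift u) a ↔ Annihilates ψ a := by
  simp only [Annihilates, AddChar.mulShift_apply]
  constructor
  · intro h r
    have := h (↑u⁻¹ * r)
    simpa only [← mul_assoc, Units.mul_inv, one_mul] using this
  · intro h r
    have := h (u * r)
    simpa only [mul_assoc] using this

theorem annProb_mulShift {ι : Type*} [Fintype ι] (w : R → ℝ) (ψ : ι → AddChar R ℂ) (u : Rˣ) :
    annProb w (fun i => (ψ i).mulShift u) = annProb w ψ := by
  simp only [annProb, annihilates_mulShift]

theorem sum_annProb_pow_mulShift {ι : Type*} [Fintype ι] (w : R → ℝ) (u : Rˣ) (L m : ℕ) :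
    ∑ ψ : ι → AddChar R ℂ with (∃ i, ψ i ≠ 0) ∧ nonflatCount w ψ u ≤ L, annProb w ψ ^ m =
      ∑ ψ : ι → AddChar R ℂ with (∃ i, ψ i ≠ 0) ∧ nonflatCount w ψ 1 ≤ L, annProb w ψ ^ m := by
  have hinv (v : Rˣ) (χ : AddChar R ℂ) : (χ.mulShift ↑v⁻¹).mulShift v = χ := by
    ext x; simp
  have hinv' (v : Rˣ) (χ : AddChar R ℂ) : (χ.mulShift v).mulShift ↑v⁻¹ = χ := by
    ext x; simp
  have hne (v : Rˣ) (χ : AddChar R ℂ) : χ.mulShift v ≠ 0 ↔ χ ≠ 0 :=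
    not_congr (AddChar.mulShift_unit_eq_one_iff χ v.isUnit)
  have hcount (ψ : ι → AddChar R ℂ) :
      nonflatCount w (fun i => (ψ i).mulShift u) 1 = nonflatCount w ψ u := by
    simp only [nonflatCount, AddChar.mulShift_one]
  refine Finset.sum_bij' (fun ψ _ i => (ψ i).mulShift u) (fun ψ _ i => (ψ i).mulShift ↑u⁻¹)
    ?_ ?_ ?_ ?_ ?_
  · intro ψ hψ
    simpa only [Finset.mem_filter, Finset.mem_univ, true_and, hne, hcount] using hψ
  · intro ψ hψ
    simp only [Finset.mem_filter, Finset.mem_univ, true_and, hne] at hψ ⊢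
    rw [← hcount]
    simpa only [hinv] using hψ
  · intro ψ _
    funext i
    exact hinv' u _
  · intro ψ _
    funext i
    exact hinv u _
  · intro ψ _
    rw [annProb_mulShift]

variable [IsLocalRing R]

open IsLocalRing

/-- A matrix over a local ring that is injective modulo the maximal ideal. -/
def IsResiduallyInjective {ι κ : Type*} [Fintype κ] (A : Matrix ι κ R) : Prop :=
  ∀ v : κ → R, (∀ i, A.mulVec v i ∈ maximalIdeal R) → ∀ j, v j ∈ maximalIdeal R

theorem exists_ne_zero_mem_annChars :
    ∃ χ ∈ annChars (maximalIdeal R).toAddSubgroup, χ ≠ 0 := by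
  obtain ⟨χ, hχ⟩ := AddChar.exists_apply_ne_zero.2 (one_ne_zero (α := R ⧸ maximalIdeal R))
  refine ⟨χ.compAddMonoidHom (Ideal.Quotient.mk (maximalIdeal R)).toAddMonoidHom, ?_, ?_⟩
  · refine Finset.mem_filter.2 ⟨Finset.mem_univ _, fun z hz => ?_⟩
    have : Ideal.Quotient.mk (maximalIdeal R) z = 0 := Ideal.Quotient.eq_zero_iff_mem.2 hz
    simp [this]
  · exact AddChar.ne_zero_iff.2 ⟨1, by simpa using hχ⟩

/-- Compose a residual kernel vector with a nonzero character that is trivial on the maximal ideal;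
a unit coordinate of the vector keeps the family nonzero. -/
theorem exists_annihilates_of_not_isResiduallyInjective {ι κ : Type*} [Fintype κ]
    {A : Matrix ι κ R} (hA : ¬ IsResiduallyInjective A) :
    ∃ ψ : κ → AddChar R ℂ, (∃ j, ψ j ≠ 0) ∧
      (∀ j, ψ j ∈ annChars (maximalIdeal R).toAddSubgroup) ∧ ∀ i, Annihilates ψ (A.row i) := by
  obtain ⟨χ, hχ, hχ0⟩ := exists_ne_zero_mem_annChars (R := R)
  have hχ1 := (Finset.mem_filter.1 hχ).2
  simp only [IsResiduallyInjective, not_forall] at hA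
  obtain ⟨v, hv, j, hj⟩ := hA
  have hu : IsUnit (v j) := by simpa using hj
  refine ⟨fun j => χ.mulShift (v j), ⟨j, fun h => hχ0 ?_⟩, fun j => ?_, fun i r => ?_⟩
  · exact (AddChar.mulShift_unit_eq_one_iff χ hu).1 h
  · refine Finset.mem_filter.2 ⟨Finset.mem_univ _, fun z hz => ?_⟩
    exact hχ1 _ (Ideal.mul_mem_left _ _ hz)
  · have h1 : ∏ j, χ (v j * (r * A i j)) = χ (∑ j, v j * (r * A i j)) := by
      have := map_sum χ.toAddMonoidHom (fun j => v j * (r * A i j)) Finset.univ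
      exact (congrArg Additive.toMul this).symm
    simp only [AddChar.mulShift_apply, Matrix.row_apply]
    rw [h1]
    refine hχ1 _ ?_
    have h2 : ∑ j, v j * (r * A i j) = r * A.mulVec v i := by
      simp only [Matrix.mulVec, dotProduct, Finset.mul_sum]
      exact Finset.sum_congr rfl fun j _ => by ring
    rw [h2]
    exact Ideal.mul_mem_left _ _ (hv i)

/-- The density of the maximal ideal. -/
noncomputable def maxIdealDensity (R : Type*) [CommRing R] [Fintype R] [IsLocalRing R] : ℝ :=
  #{r : R | r ∈ maximalIdeal R} / Fintype.card R

theorem maxIdealDensity_pos : 0 < maxIdealDensity R := by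
  refine div_pos (Nat.cast_pos.2 (Finset.card_pos.2 ⟨0, ?_⟩)) (Nat.cast_pos.2 Fintype.card_pos)
  simp

theorem maxIdealDensity_lt_one : maxIdealDensity R < 1 := by
  rw [maxIdealDensity, div_lt_one (Nat.cast_pos.2 Fintype.card_pos), Nat.cast_lt]
  refine Finset.card_lt_univ_of_notMem (x := 1) ?_
  simp

theorem card_annChars_mul_maxIdealDensity_le :
    #(annChars (maximalIdeal R).toAddSubgroup) * maxIdealDensity R ≤ 1 := by
  rw [maxIdealDensity, ← mul_div_assoc, div_le_one (Nat.cast_pos.2 Fintype.card_pos)]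
  have := card_annChars_mul_le (maximalIdeal R).toAddSubgroup
  have h2 : Nat.card (maximalIdeal R).toAddSubgroup = #{r : R | r ∈ maximalIdeal R} := by
    rw [Nat.card_eq_fintype_card, Fintype.card_subtype]
    rfl
  rw [h2] at this
  exact_mod_cast this

/-- Union bound over families with values in `X`. When all unit shifts are far from flat, `annProb`
is at most `s + ρ ^ m.sqrt`; since `|X| * s ≤ 1`, only the `k` surplus rows contribute, giving about
`s ^ k`. Families with a mostly flat unit shift are handled by the first moment bound. -/
theorem IsSpreadWeight.eventually_not_isResiduallyInjective_le (hw : IsSpreadWeight w)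
    (h0 : 0 ≤ ρ) (h1 : ρ < 1) (hρ : ∀ ψ, ¬ IsFlat w ψ → ‖charSum w ψ‖ ≤ ρ) (k : ℕ) :
    ∀ᶠ m : ℕ in Filter.atTop,
      ∑ A : Matrix (Fin m ⊕ Fin k) (Fin m) R with ¬ IsResiduallyInjective A, matWeight w A ≤
        2 * maxIdealDensity R ^ k := by
  obtain ⟨s, hs⟩ : ∃ s, s = maxIdealDensity R := ⟨_, rfl⟩
  have hs0 : 0 < s := hs ▸ maxIdealDensity_pos
  set N : ℝ := (Fintype.card R : ℝ) with hN'
  have hN : (1 : ℝ) ≤ N := Nat.one_le_cast.2 Fintype.card_pos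
  set X := annChars (maximalIdeal R).toAddSubgroup with hX
  have hXN : (#X : ℝ) ≤ N := by
    have := Finset.card_le_univ X
    rw [AddChar.card_eq] at this
    exact Nat.cast_le.2 this
  have hXs : (#X : ℝ) * s ≤ 1 := hs ▸ card_annChars_mul_maxIdealDensity_le
  have hsq : Filter.Tendsto Nat.sqrt Filter.atTop Filter.atTop :=
    Filter.tendsto_atTop_atTop.2 fun b => ⟨b * b, fun a ha => Nat.le_sqrt.2 ha⟩
  have hlim : Filter.Tendsto (fun m : ℕ => Real.exp (N * (m * ρ ^ m.sqrt)) *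
      (s + ρ ^ m.sqrt) ^ k) Filter.atTop (nhds (s ^ k)) := by
    have e1 : Filter.Tendsto (fun m : ℕ => Real.exp (N * (m * ρ ^ m.sqrt))) Filter.atTop
        (nhds 1) := by
      have := (Real.continuous_exp.tendsto _).comp ((tendsto_mul_pow_sqrt h0 h1).const_mul N)
      simpa [Function.comp_def] using this
    have e2 : Filter.Tendsto (fun m : ℕ => (s + ρ ^ m.sqrt) ^ k) Filter.atTop
        (nhds (s ^ k)) := by
      have := (((tendsto_pow_atTop_nhds_zero_of_lt_one h0 h1).comp hsq).const_add s).pow k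
      simpa using this
    simpa using e1.mul e2
  have hev1 := hlim.eventually_le_const (u := 3 / 2 * s ^ k) (by
    have : 0 < s ^ k := by positivity
    linarith)
  -- One share of `s ^ k / 2` for each unit shift.
  have hev2 := hw.eventually_sum_annProb_pow_le h0 h1 hρ 0
    (ε := 1 / 2 * s ^ k / Fintype.card Rˣ) (by positivity)
  filter_upwards [hev1, hev2] with m hm1 hm2
  rw [← hs]
  have hm3 := hm2 (Fin m) (by simp)
  have hpow (ψ : Fin m → AddChar R ℂ) (n : ℕ) : 0 ≤ annProb w ψ ^ n :=
    pow_nonneg (hw.annProb_nonneg ψ) _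
  have hsub : ({A : Matrix (Fin m ⊕ Fin k) (Fin m) R | ¬ IsResiduallyInjective A} :
      Finset (Matrix (Fin m ⊕ Fin k) (Fin m) R)) ⊆
      ({ψ : Fin m → AddChar R ℂ | (∃ j, ψ j ≠ 0) ∧ ∀ j, ψ j ∈ X} :
        Finset (Fin m → AddChar R ℂ)).biUnion fun ψ =>
          Finset.univ.filter fun A => ∀ i, Annihilates ψ (A.row i) := by
    intro A hA
    obtain ⟨ψ, h2, h3, h4⟩ :=
      exists_annihilates_of_not_isResiduallyInjective (Finset.mem_filter.1 hA).2
    exact Finset.mem_biUnion.2 ⟨ψ, Finset.mem_filter.2 ⟨Finset.mem_univ _, h2, h3⟩,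
      Finset.mem_filter.2 ⟨Finset.mem_univ _, h4⟩⟩
  refine (Finset.sum_le_sum_of_subset_of_nonneg hsub fun A _ _ =>
    hw.matWeight_nonneg A).trans ?_
  refine (sum_biUnion_le_sum _ _ fun A => hw.matWeight_nonneg A).trans ?_
  have hterm (ψ : Fin m → AddChar R ℂ) :
      ∑ A : Matrix (Fin m ⊕ Fin k) (Fin m) R with ∀ i, Annihilates ψ (A.row i), matWeight w A =
        annProb w ψ ^ (m + k) := by
    have h2 := sum_matWeight_filter (ι := Fin m ⊕ Fin k) w (Annihilates ψ)
    rw [Fintype.card_sum, Fintype.card_fin, Fintype.card_fin] at h2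
    rw [annProb]
    convert h2
  simp only [hterm]
  have hsub2 : ({ψ : Fin m → AddChar R ℂ | (∃ j, ψ j ≠ 0) ∧ ∀ j, ψ j ∈ X} :
      Finset (Fin m → AddChar R ℂ)) ⊆
      ({ψ : Fin m → AddChar R ℂ | (∀ j, ψ j ∈ X) ∧
        ∀ r ∉ maximalIdeal R, m.sqrt < nonflatCount w ψ r} : Finset (Fin m → AddChar R ℂ)) ∪
      (Finset.univ : Finset Rˣ).biUnion fun u =>
        Finset.univ.filter fun ψ => (∃ i, ψ i ≠ 0) ∧ nonflatCount w ψ u ≤ m.sqrt := by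
    intro ψ hψ
    obtain ⟨h2, h3⟩ := (Finset.mem_filter.1 hψ).2
    rw [Finset.mem_union]
    by_cases h : ∀ r ∉ maximalIdeal R, m.sqrt < nonflatCount w ψ r
    · left
      exact Finset.mem_filter.2 ⟨Finset.mem_univ _, h3, h⟩
    · right
      push Not at h
      obtain ⟨r, hr, hr2⟩ := h
      obtain ⟨u, rfl⟩ : IsUnit r := by simpa using hr
      exact Finset.mem_biUnion.2 ⟨u, Finset.mem_univ _,
        Finset.mem_filter.2 ⟨Finset.mem_univ _, h2, hr2⟩⟩
  refine (Finset.sum_le_sum_of_subset_of_nonneg hsub2 fun ψ _ _ => hpow ψ _).trans ?_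
  have hunion (a b : Finset (Fin m → AddChar R ℂ)) :
      ∑ ψ ∈ a ∪ b, annProb w ψ ^ (m + k) ≤
        ∑ ψ ∈ a, annProb w ψ ^ (m + k) + ∑ ψ ∈ b, annProb w ψ ^ (m + k) := by
    rw [← Finset.sum_union_inter]
    exact le_add_of_nonneg_right (Finset.sum_nonneg fun ψ _ => hpow ψ _)
  refine (hunion _ _).trans ?_
  have hfirst : ∑ ψ : Fin m → AddChar R ℂ with (∀ j, ψ j ∈ X) ∧
      ∀ r ∉ maximalIdeal R, m.sqrt < nonflatCount w ψ r, annProb w ψ ^ (m + k) ≤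
        3 / 2 * s ^ k := by
    refine le_trans ?_ hm1
    have hq (ψ : Fin m → AddChar R ℂ)
        (h : ∀ r ∉ maximalIdeal R, m.sqrt < nonflatCount w ψ r) :
        annProb w ψ ≤ s + ρ ^ m.sqrt := by
      have h2 := hw.annProb_le_of_lt_nonflatCount h0 h1.le hρ (ψ := ψ)
        (T := {r : R | r ∈ maximalIdeal R}) (L := m.sqrt) (fun r hr => h r (by simpa using hr))
      have h3 : (#{r : R | r ∈ maximalIdeal R} : ℝ) = N * s := by
        rw [hs, maxIdealDensity, mul_div_cancel₀ _ (by linarith)]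
      rw [← hN', h3, ← mul_add] at h2
      exact le_of_mul_le_mul_left h2 (by linarith)
    have hcard : #{ψ : Fin m → AddChar R ℂ | (∀ j, ψ j ∈ X) ∧
        ∀ r ∉ maximalIdeal R, m.sqrt < nonflatCount w ψ r} ≤ #X ^ m := by
      have : #(Fintype.piFinset fun _ : Fin m => X) = #X ^ m := by simp
      rw [← this]
      refine Finset.card_le_card fun ψ hψ => ?_
      exact Fintype.mem_piFinset.2 (Finset.mem_filter.1 hψ).2.1
    calc _ ≤ ∑ ψ : Fin m → AddChar R ℂ with (∀ j, ψ j ∈ X) ∧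
        ∀ r ∉ maximalIdeal R, m.sqrt < nonflatCount w ψ r, (s + ρ ^ m.sqrt) ^ (m + k) :=
          Finset.sum_le_sum fun ψ hψ => pow_le_pow_left₀ (hw.annProb_nonneg ψ)
            (hq ψ (Finset.mem_filter.1 hψ).2.2) _
      _ ≤ (#X : ℝ) ^ m * (s + ρ ^ m.sqrt) ^ (m + k) := by
          rw [Finset.sum_const, nsmul_eq_mul]
          refine mul_le_mul_of_nonneg_right ?_ (by positivity)
          exact_mod_cast hcard
      _ = (#X * s + #X * ρ ^ m.sqrt) ^ m * (s + ρ ^ m.sqrt) ^ k := by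
          rw [pow_add, ← mul_assoc, ← mul_pow, mul_add]
      _ ≤ Real.exp (N * ρ ^ m.sqrt) ^ m * (s + ρ ^ m.sqrt) ^ k := by
          refine mul_le_mul_of_nonneg_right (pow_le_pow_left₀ (by positivity) ?_ _)
            (by positivity)
          have h2 := Real.add_one_le_exp (N * ρ ^ m.sqrt)
          have h3 : #X * ρ ^ m.sqrt ≤ N * ρ ^ m.sqrt :=
            mul_le_mul_of_nonneg_right hXN (by positivity)
          linarith
      _ = _ := by rw [← Real.exp_nat_mul]; congr 2; ring
  have hsecond : ∑ ψ ∈ (Finset.univ : Finset Rˣ).biUnion fun u =>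
      Finset.univ.filter fun ψ : Fin m → AddChar R ℂ =>
        (∃ i, ψ i ≠ 0) ∧ nonflatCount w ψ u ≤ m.sqrt, annProb w ψ ^ (m + k) ≤
          1 / 2 * s ^ k := by
    refine (sum_biUnion_le_sum _ _ fun ψ => hpow ψ _).trans ?_
    have h2 (u : Rˣ) : ∑ ψ : Fin m → AddChar R ℂ with
        (∃ i, ψ i ≠ 0) ∧ nonflatCount w ψ u ≤ m.sqrt, annProb w ψ ^ (m + k) ≤
          1 / 2 * s ^ k / Fintype.card Rˣ := by
      calc _ ≤ ∑ ψ : Fin m → AddChar R ℂ with (∃ i, ψ i ≠ 0) ∧ nonflatCount w ψ u ≤ m.sqrt,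
            annProb w ψ ^ m :=
            Finset.sum_le_sum fun ψ _ => pow_le_pow_of_le_one (hw.annProb_nonneg ψ)
              (hw.annProb_le_one ψ) (Nat.le_add_right m k)
        _ = ∑ ψ : Fin m → AddChar R ℂ with (∃ i, ψ i ≠ 0) ∧ nonflatCount w ψ 1 ≤ m.sqrt,
            annProb w ψ ^ m := by convert sum_annProb_pow_mulShift w u m.sqrt m
        _ ≤ _ := by convert hm3
    refine (Finset.sum_le_card_nsmul _ _ _ fun u _ => h2 u).trans ?_
    rw [nsmul_eq_mul, Finset.card_univ, mul_div_cancel₀]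
    exact Nat.cast_ne_zero.2 Fintype.card_ne_zero
  linarith

end Rank

/-! ### Families annihilating the columns of `A` are far from flat. -/

section Annihilator

variable {R : Type*} [CommRing R] [Fintype R] {w : R → ℝ} {ρ : ℝ}

/-- Every nonzero family orthogonal to all columns of `A` has more than `L` coordinates that are
not flat. -/
def IsSpreadMatrix {ι κ : Type*} [Fintype ι] (w : R → ℝ) (L : ℕ) (A : Matrix ι κ R) : Prop :=
  ∀ ψ : ι → AddChar R ℂ, (∃ i, ψ i ≠ 0) → (∀ j, Annihilates ψ (A.col j)) →
    L < nonflatCount w ψ 1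

theorem IsSpreadWeight.eventually_not_isSpreadMatrix_le (hw : IsSpreadWeight w)
    (h0 : 0 ≤ ρ) (h1 : ρ < 1) (hρ : ∀ ψ, ¬ IsFlat w ψ → ‖charSum w ψ‖ ≤ ρ) (k : ℕ) {ε : ℝ}
    (hε : 0 < ε) :
    ∀ᶠ m : ℕ in Filter.atTop,
      ∑ A : Matrix (Fin m ⊕ Fin k) (Fin m) R with ¬ IsSpreadMatrix w m.sqrt A,
        matWeight w A ≤ ε := by
  filter_upwards [hw.eventually_sum_annProb_pow_le h0 h1 hρ k hε] with m hm
  refine le_trans ?_ (hm (Fin m ⊕ Fin k) (by simp))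
  have hsub : ({A : Matrix (Fin m ⊕ Fin k) (Fin m) R | ¬ IsSpreadMatrix w m.sqrt A} :
      Finset (Matrix (Fin m ⊕ Fin k) (Fin m) R)) ⊆
      ({ψ : Fin m ⊕ Fin k → AddChar R ℂ | (∃ i, ψ i ≠ 0) ∧ nonflatCount w ψ 1 ≤ m.sqrt} :
        Finset (Fin m ⊕ Fin k → AddChar R ℂ)).biUnion fun ψ =>
          Finset.univ.filter fun A => ∀ j, Annihilates ψ (A.col j) := by
    intro A hA
    have hA' := (Finset.mem_filter.1 hA).2
    simp only [IsSpreadMatrix, not_forall, not_lt] at hA'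
    obtain ⟨ψ, h2, h3, h4⟩ := hA'
    exact Finset.mem_biUnion.2 ⟨ψ, Finset.mem_filter.2 ⟨Finset.mem_univ _, h2, h4⟩,
      Finset.mem_filter.2 ⟨Finset.mem_univ _, h3⟩⟩
  refine (Finset.sum_le_sum_of_subset_of_nonneg hsub fun A _ _ =>
    hw.matWeight_nonneg A).trans ?_
  refine (sum_biUnion_le_sum _ _ fun A => hw.matWeight_nonneg A).trans (le_of_eq ?_)
  refine Finset.sum_congr (by congr!) fun ψ _ => ?_
  have h2 := sum_matWeight_filter_transpose (κ := Fin m) w (Annihilates ψ)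
  rw [Fintype.card_fin] at h2
  rw [annProb]
  convert h2

end Annihilator

/-! ### Near-uniformity of the projected columns. -/

section Projection

variable {R : Type*} [CommRing R] [Fintype R] {w : R → ℝ} {ρ : ℝ}
  {ι κ : Type*} [Fintype ι] [Fintype κ] [DecidableEq ι] [DecidableEq κ]

/-- The pullback of a character along a matrix, as a family of characters. -/
noncomputable def pullbackChar {R ι κ : Type*} [CommRing R] [Fintype ι] [DecidableEq ι]
    (φ : Matrix κ ι R) (χ : AddChar (κ → R) ℂ) (i : ι) : AddChar R ℂ :=
  χ.compAddMonoidHom (φ.mulVecLin.toAddMonoidHom.comp (AddMonoidHom.single (fun _ : ι => R) i))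

theorem prod_pullbackChar {R ι κ : Type*} [CommRing R] [Fintype ι] [DecidableEq ι] (φ : Matrix κ ι R) (χ : AddChar (κ → R) ℂ) (a : ι → R) :
    ∏ i, pullbackChar φ χ i (a i) = χ (φ.mulVec a) := by
  have h1 : ∑ i, φ.mulVec (Pi.single i (a i)) = φ.mulVec a := by
    have := map_sum φ.mulVecLin (fun i => Pi.single i (a i)) Finset.univ
    rw [Finset.univ_sum_single] at this
    simpa using this.symm
  have h2 := map_sum χ.toAddMonoidHom (fun i => φ.mulVec (Pi.single i (a i))) Finset.univ
  rw [h1] at h2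
  exact (congrArg Additive.toMul h2).symm

theorem exists_pullbackChar_ne_zero {R ι κ : Type*} [CommRing R] [Fintype ι] [DecidableEq ι]
    {φ : Matrix κ ι R} (hφ : Function.Surjective φ.mulVec)
    {χ : AddChar (κ → R) ℂ} (hχ : χ ≠ 0) : ∃ i, pullbackChar φ χ i ≠ 0 := by
  by_contra! h
  refine hχ (AddChar.eq_zero_iff.2 fun y => ?_)
  obtain ⟨a, rfl⟩ := hφ y
  rw [← prod_pullbackChar]
  exact Finset.prod_eq_one fun i _ => by rw [h i, AddChar.zero_apply]

theorem annihilates_pullbackChar {R ι κ : Type*} [CommRing R] [Fintype ι] [DecidableEq ι]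
    {φ : Matrix κ ι R} (χ : AddChar (κ → R) ℂ) {a : ι → R}
    (ha : φ.mulVec a = 0) : Annihilates (pullbackChar φ χ) a := by
  intro r
  have h := prod_pullbackChar φ χ (r • a)
  rw [Matrix.mulVec_smul, ha, smul_zero, AddChar.map_zero_eq_one] at h
  simpa using h

/-- Fourier inversion on `κ → R`: the trivial character gives the uniform mass, each other
coefficient is at most `ρ ^ L`, and their number is absorbed by the normalising factor. -/
theorem IsWeight.abs_sum_mulVec_eq_sub_le (hw : IsWeight w) (h0 : 0 ≤ ρ) (h1 : ρ ≤ 1)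
    (hρ : ∀ ψ, ¬ IsFlat w ψ → ‖charSum w ψ‖ ≤ ρ) (φ : Matrix κ ι R) {L : ℕ}
    (hL : ∀ χ : AddChar (κ → R) ℂ, χ ≠ 0 → L ≤ nonflatCount w (pullbackChar φ χ) 1)
    (y : κ → R) :
    |∑ a : ι → R with φ.mulVec a = y, vecWeight w a - ((Fintype.card (κ → R) : ℝ))⁻¹| ≤
      ρ ^ L := by
  set p : ℝ := ∑ a : ι → R with φ.mulVec a = y, vecWeight w a with hp
  have hM : (0 : ℝ) < Fintype.card (κ → R) := Nat.cast_pos.2 Fintype.card_pos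
  have hfourier : (Fintype.card (κ → R) : ℂ) * p =
      ∑ χ : AddChar (κ → R) ℂ, χ (-y) * ∏ i, charSum w (pullbackChar φ χ i) := by
    simp only [← sum_vecWeight_mul_prod, Finset.mul_sum]
    rw [Finset.sum_comm, hp]
    push_cast
    rw [Finset.sum_filter, Finset.mul_sum]
    refine Finset.sum_congr rfl fun a _ => ?_
    have h2 (χ : AddChar (κ → R) ℂ) : χ (-y) * (vecWeight w a * ∏ i, pullbackChar φ χ i (a i)) =
        vecWeight w a * χ (φ.mulVec a - y) := by
      rw [prod_pullbackChar, sub_eq_neg_add, AddChar.map_add_eq_mul]; ring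
    simp only [h2]
    rw [← Finset.mul_sum, AddChar.sum_apply_eq_ite]
    simp only [sub_eq_zero]
    split_ifs <;> ring
  have hdiff : (Fintype.card (κ → R) : ℂ) * p - 1 =
      ∑ χ ∈ (Finset.univ : Finset (AddChar (κ → R) ℂ)).erase 0,
        χ (-y) * ∏ i, charSum w (pullbackChar φ χ i) := by
    rw [hfourier, ← Finset.add_sum_erase _ _ (Finset.mem_univ 0)]
    have h3 : ∏ i, charSum w (pullbackChar φ 0 i) = 1 := by
      refine Finset.prod_eq_one fun i _ => ?_
      have : pullbackChar φ 0 i = 0 := by ext x; simp [pullbackChar]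
      rw [this]
      simp only [charSum, AddChar.zero_apply, mul_one]
      exact_mod_cast congrArg (fun r : ℝ => (r : ℂ)) hw.sum_eq_one
    rw [h3]
    simp
  have hnorm : ‖(Fintype.card (κ → R) : ℂ) * p - 1‖ ≤ Fintype.card (κ → R) * ρ ^ L := by
    rw [hdiff]
    refine (norm_sum_le _ _).trans ?_
    have hterm : ∀ χ ∈ (Finset.univ : Finset (AddChar (κ → R) ℂ)).erase 0,
        ‖χ (-y) * ∏ i, charSum w (pullbackChar φ χ i)‖ ≤ ρ ^ L := by
      intro χ hχ
      have h4 := hw.norm_prod_charSum_le hρ (pullbackChar φ χ) 1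
      simp only [AddChar.mulShift_one] at h4
      rw [norm_mul, AddChar.norm_apply, one_mul]
      exact h4.trans (pow_le_pow_of_le_one h0 h1 (hL χ (Finset.ne_of_mem_erase hχ)))
    refine (Finset.sum_le_card_nsmul _ _ _ hterm).trans ?_
    rw [nsmul_eq_mul]
    refine mul_le_mul_of_nonneg_right (Nat.cast_le.2 ?_) (by positivity)
    rw [← AddChar.card_eq (α := κ → R)]
    exact Finset.card_le_card (Finset.subset_univ _)
  have h5 : ‖(Fintype.card (κ → R) : ℂ) * p - 1‖ =
      Fintype.card (κ → R) * |p - ((Fintype.card (κ → R) : ℝ))⁻¹| := by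
    rw [← abs_of_pos hM, ← abs_mul, mul_sub, abs_of_pos hM, mul_inv_cancel₀ hM.ne',
      ← Real.norm_eq_abs, ← Complex.norm_real]
    push_cast
    rfl
  rw [h5] at hnorm
  exact le_of_mul_le_mul_left hnorm hM

theorem abs_prod_sub_prod_le {α : Type*} (s : Finset α) {f g : α → ℝ} {δ : ℝ}
    (hf0 : ∀ i ∈ s, 0 ≤ f i) (hf1 : ∀ i ∈ s, f i ≤ 1) (hg0 : ∀ i ∈ s, 0 ≤ g i)
    (hg1 : ∀ i ∈ s, g i ≤ 1) (h : ∀ i ∈ s, |f i - g i| ≤ δ) :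
    |∏ i ∈ s, f i - ∏ i ∈ s, g i| ≤ #s * δ := by
  induction s using Finset.induction_on with
  | empty => simp
  | insert a s ha ih =>
    simp only [Finset.mem_insert, forall_eq_or_imp] at hf0 hf1 hg0 hg1 h
    have ih' := ih hf0.2 hf1.2 hg0.2 hg1.2 h.2
    rw [Finset.prod_insert ha, Finset.prod_insert ha, Finset.card_insert_of_notMem ha]
    have hP0 : 0 ≤ ∏ i ∈ s, f i := Finset.prod_nonneg hf0.2
    have hP1 : ∏ i ∈ s, f i ≤ 1 := Finset.prod_le_one hf0.2 hf1.2
    have e : f a * ∏ i ∈ s, f i - g a * ∏ i ∈ s, g i =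
        (f a - g a) * ∏ i ∈ s, f i + g a * (∏ i ∈ s, f i - ∏ i ∈ s, g i) := by ring
    rw [e]
    refine (abs_add_le _ _).trans ?_
    rw [abs_mul, abs_mul, abs_of_nonneg hP0, abs_of_nonneg hg0.1]
    have h2 : |f a - g a| * ∏ i ∈ s, f i ≤ |f a - g a| :=
      mul_le_of_le_one_right (abs_nonneg _) hP1
    have h3 : g a * |∏ i ∈ s, f i - ∏ i ∈ s, g i| ≤ |∏ i ∈ s, f i - ∏ i ∈ s, g i| :=
      mul_le_of_le_one_left (abs_nonneg _) hg1.1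
    push_cast
    linarith [h.1]

/-- The probability that a random matrix has determinant `x`. -/
noncomputable def detProb (w : R → ℝ) (ι : Type*) [Fintype ι] [DecidableEq ι] (x : R) : ℝ :=
  ∑ A : Matrix ι ι R with A.det = x, matWeight w A

/-- The uniform weight. -/
noncomputable def uniformWeight (R : Type*) [Fintype R] : R → ℝ :=
  fun _ => (Fintype.card R : ℝ)⁻¹

theorem matWeight_uniformWeight {R ι κ : Type*} [Fintype R] [Fintype ι] [Fintype κ]
    [DecidableEq κ] (B : Matrix κ ι R) :
    matWeight (uniformWeight R) B =
      ∏ _j : ι, ((Fintype.card (κ → R) : ℝ))⁻¹ := by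
  rw [← matWeight_transpose]
  simp [matWeight, vecWeight, uniformWeight]

/-- Scaling one row by a unit is a bijection preserving the uniform weight. A row must exist: the
empty determinant is always one. -/
theorem detProb_uniformWeight_mul [Nonempty κ] (u : Rˣ) (x : R) :
    detProb (uniformWeight R) κ (u * x) = detProb (uniformWeight R) κ x := by
  obtain ⟨i₀⟩ := ‹Nonempty κ›
  have hinv (v : Rˣ) (A : Matrix κ κ R) :
      (A.updateRow i₀ ((v : R) • A.row i₀)).updateRow i₀
        ((↑v⁻¹ : R) • (A.updateRow i₀ ((v : R) • A.row i₀)).row i₀) = A := by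
    ext i j
    by_cases h : i = i₀
    · subst h; simp [Matrix.row]
    · simp [Matrix.updateRow_ne h]
  have hdet (v : Rˣ) (A : Matrix κ κ R) :
      (A.updateRow i₀ ((v : R) • A.row i₀)).det = v * A.det := by
    rw [Matrix.det_updateRow_smul]
    congr 2
    exact Matrix.updateRow_eq_self A i₀
  refine Finset.sum_bij' (fun A _ => A.updateRow i₀ ((↑u⁻¹ : R) • A.row i₀))
    (fun A _ => A.updateRow i₀ ((u : R) • A.row i₀)) ?_ ?_ ?_ ?_ ?_
  · intro A hA
    simp only [Finset.mem_filter, Finset.mem_univ, true_and] at hA ⊢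
    rw [hdet, hA, Units.inv_mul_cancel_left]
  · intro A hA
    simp only [Finset.mem_filter, Finset.mem_univ, true_and] at hA ⊢
    rw [hdet, hA]
  · intro A _
    simpa using hinv u⁻¹ A
  · intro A _
    exact hinv u A
  · intro A _
    rw [matWeight_uniformWeight, matWeight_uniformWeight]

theorem sum_matWeight_mul_eq (w : R → ℝ) (φ : Matrix κ ι R) (B : Matrix κ κ R) :
    ∑ C : Matrix ι κ R with φ * C = B, matWeight w C =
      ∏ j, ∑ a : ι → R with φ.mulVec a = B.col j, vecWeight w a := by
  have h := sum_prod_rows_filter (vecWeight w) fun j a => φ.mulVec a = B.col j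
  refine Eq.trans ?_ (h.trans (by congr!))
  refine Finset.sum_bij' (fun C _ => C.col) (fun A _ => (Matrix.of A).transpose) ?_ ?_ ?_ ?_ ?_
  · intro C hC
    simp only [Finset.mem_filter, Finset.mem_univ, true_and] at hC ⊢
    intro j
    rw [← hC]
    rfl
  · intro A hA
    simp only [Finset.mem_filter, Finset.mem_univ, true_and] at hA ⊢
    ext i j
    exact congrFun (hA j) i
  · intro C _; rfl
  · intro A _; rfl
  · intro C _
    rw [← matWeight_transpose]
    rfl

theorem IsWeight.abs_sum_det_mul_sub_le (hw : IsWeight w) (φ : Matrix κ ι R)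
    {δ : ℝ} (hδ : ∀ y : κ → R,
      |∑ a : ι → R with φ.mulVec a = y, vecWeight w a - ((Fintype.card (κ → R) : ℝ))⁻¹| ≤ δ)
    (x : R) :
    |∑ C : Matrix ι κ R with (φ * C).det = x, matWeight w C - detProb (uniformWeight R) κ x| ≤
      Fintype.card (Matrix κ κ R) * (Fintype.card κ * δ) := by
  have h1 : ∑ C : Matrix ι κ R with (φ * C).det = x, matWeight w C =
      ∑ B : Matrix κ κ R with B.det = x, ∑ C : Matrix ι κ R with φ * C = B, matWeight w C := by
    rw [← Finset.sum_fiberwise_of_maps_to (g := fun C => φ * C)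
      (t := ({B | B.det = x} : Finset (Matrix κ κ R))) (by simp)]
    refine Finset.sum_congr rfl fun B hB => ?_
    rw [Finset.filter_filter]
    refine Finset.sum_congr (Finset.filter_congr fun C _ => ?_) fun _ _ => rfl
    have hB' := (Finset.mem_filter.1 hB).2
    exact ⟨fun h => h.2, fun h => ⟨by rw [h, hB'], h⟩⟩
  have hδ0 : 0 ≤ δ := (abs_nonneg _).trans (hδ 0)
  rw [h1, detProb, ← Finset.sum_sub_distrib]
  refine (Finset.abs_sum_le_sum_abs _ _).trans ?_
  have hterm (B : Matrix κ κ R) : |∑ C : Matrix ι κ R with φ * C = B, matWeight w C -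
      matWeight (uniformWeight R) B| ≤ Fintype.card κ * δ := by
    rw [sum_matWeight_mul_eq, matWeight_uniformWeight, ← Finset.card_univ]
    refine abs_prod_sub_prod_le _ (fun j _ => Finset.sum_nonneg fun a _ =>
      hw.vecWeight_nonneg a) (fun j _ => ?_) (fun _ _ => by positivity) (fun _ _ => ?_)
      fun j _ => hδ _
    · rw [← hw.sum_vecWeight (ι := ι)]
      exact Finset.sum_le_sum_of_subset_of_nonneg (Finset.filter_subset _ _)
        fun a _ _ => hw.vecWeight_nonneg a
    · exact inv_le_one_of_one_le₀ (Nat.one_le_cast.2 Fintype.card_pos)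
  refine (Finset.sum_le_card_nsmul _ _ _ fun B _ => hterm B).trans ?_
  rw [nsmul_eq_mul]
  exact mul_le_mul_of_nonneg_right
    (Nat.cast_le.2 (Finset.card_le_card (Finset.subset_univ _))) (by positivity)

end Projection

/-! ### Completing `A` to an invertible matrix over the local ring. -/

section Completion

variable {R : Type*} [CommRing R] [IsLocalRing R]

open IsLocalRing

/-- A linearly independent family of the right size extends to an invertible matrix. -/
theorem exists_isUnit_det_fromCols_of_field {F : Type*} [Field F] {m k : ℕ}
    (A : Matrix (Fin m ⊕ Fin k) (Fin m) F) (hA : LinearIndependent F A.col) :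
    ∃ E : Matrix (Fin m ⊕ Fin k) (Fin k) F, (Matrix.fromCols A E).det ≠ 0 := by
  set W := Submodule.span F (Set.range A.col) with hW
  obtain ⟨W', hWW'⟩ := W.exists_isCompl
  have hfin : Module.finrank F W = m := by
    rw [hW, finrank_span_eq_card hA, Fintype.card_fin]
  have hfin' : Module.finrank F W' = k := by
    have := Submodule.finrank_add_eq_of_isCompl hWW'
    rw [hfin, Module.finrank_fintype_fun_eq_card, Fintype.card_sum, Fintype.card_fin,
      Fintype.card_fin] at this
    omega
  let b := Module.finBasisOfFinrankEq F W' hfin'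
  have hb : LinearIndependent F fun j => (b j : Fin m ⊕ Fin k → F) :=
    b.linearIndependent.map' W'.subtype (Submodule.ker_subtype _)
  have hspan : Submodule.span F (Set.range fun j => (b j : Fin m ⊕ Fin k → F)) ≤ W' := by
    rw [Submodule.span_le]
    rintro _ ⟨j, rfl⟩
    exact (b j).2
  have hli := LinearIndependent.sum_type hA hb (hWW'.disjoint.mono_right hspan)
  refine ⟨(Matrix.of fun j => (b j : Fin m ⊕ Fin k → F)).transpose, ?_⟩
  have hcol : (Matrix.fromCols A
      (Matrix.of fun j => (b j : Fin m ⊕ Fin k → F)).transpose).col =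
      Sum.elim A.col fun j => (b j : Fin m ⊕ Fin k → F) := by
    funext j
    cases j <;> rfl
  rw [← isUnit_iff_ne_zero, ← Matrix.isUnit_iff_isUnit_det]
  exact Matrix.linearIndependent_cols_iff_isUnit.1 (hcol ▸ hli)

/-- Complete over the residue field and lift entrywise; over a local ring a determinant is a unit
once its residue is nonzero. -/
theorem IsResiduallyInjective.exists_isUnit_det_fromCols {m k : ℕ}
    {A : Matrix (Fin m ⊕ Fin k) (Fin m) R} (hA : IsResiduallyInjective A) :
    ∃ E : Matrix (Fin m ⊕ Fin k) (Fin k) R, IsUnit (Matrix.fromCols A E).det := by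
  have hli : LinearIndependent (ResidueField R) (A.map (residue R)).col := by
    rw [← Matrix.mulVec_injective_iff]
    refine (injective_iff_map_eq_zero (A.map (residue R)).mulVecLin).2 fun v hv => ?_
    choose v' hv' using fun j => residue_surjective (v j)
    have h := hA v' fun i => by
      rw [← residue_eq_zero_iff]
      have h2 := congrFun hv i
      simp only [Matrix.mulVecLin_apply, Matrix.mulVec, dotProduct, Matrix.map_apply,
        Pi.zero_apply] at h2
      simp only [Matrix.mulVec, dotProduct, map_sum, map_mul, hv', h2]
    funext j
    rw [← hv', Pi.zero_apply, residue_eq_zero_iff]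
    exact h j
  obtain ⟨E, hE⟩ := exists_isUnit_det_fromCols_of_field _ hli
  choose E' hE' using fun i j => residue_surjective (E i j)
  refine ⟨Matrix.of E', ?_⟩
  have hmap : (residue R).mapMatrix (Matrix.fromCols A (Matrix.of E')) =
      Matrix.fromCols (A.map (residue R)) E := by
    ext i j
    rcases j with j | j
    · simp
    · simp [hE']
  rw [← residue_ne_zero_iff_isUnit, RingHom.map_det, hmap]
  exact hE

theorem IsResiduallyInjective.exists_mul_eq_fromRows {m k : ℕ}
    {A : Matrix (Fin m ⊕ Fin k) (Fin m) R} (hA : IsResiduallyInjective A) :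
    ∃ G : Matrix (Fin m ⊕ Fin k) (Fin m ⊕ Fin k) R, IsUnit G.det ∧
      G * A = Matrix.fromRows 1 0 := by
  obtain ⟨E, hE⟩ := hA.exists_isUnit_det_fromCols
  refine ⟨(Matrix.fromCols A E)⁻¹, Matrix.isUnit_nonsing_inv_det _ hE, ?_⟩
  have h := Matrix.nonsing_inv_mul _ hE
  rw [Matrix.mul_fromCols, ← Matrix.fromBlocks_one, ← Matrix.fromCols_fromRows_eq_fromBlocks] at h
  exact (Matrix.fromCols_inj h).1

end Completion

/-! ### Reduction to a `k × k` determinant. -/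

section Determinant

variable {R : Type*} [CommRing R] [Fintype R] {w : R → ℝ} {ρ : ℝ}

theorem det_mul_det_fromCols {R : Type*} [CommRing R] {m k : ℕ} {A : Matrix (Fin m ⊕ Fin k) (Fin m) R}
    {G : Matrix (Fin m ⊕ Fin k) (Fin m ⊕ Fin k) R} (hG : G * A = Matrix.fromRows 1 0)
    (C : Matrix (Fin m ⊕ Fin k) (Fin k) R) :
    G.det * (Matrix.fromCols A C).det = (G.toRows₂ * C).det := by
  rw [← Matrix.det_mul, Matrix.mul_fromCols, hG, ← Matrix.fromRows_toRows (G * C),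
    Matrix.fromCols_fromRows_eq_fromBlocks, Matrix.det_fromBlocks_zero₂₁, Matrix.det_one, one_mul]
  rfl

theorem toRows₂_mul_eq_zero {R : Type*} [CommRing R] {m k : ℕ} {A : Matrix (Fin m ⊕ Fin k) (Fin m) R}
    {G : Matrix (Fin m ⊕ Fin k) (Fin m ⊕ Fin k) R} (hG : G * A = Matrix.fromRows 1 0) :
    G.toRows₂ * A = 0 := by
  have h : (G * A).toRows₂ = 0 := by rw [hG, Matrix.toRows₂_fromRows]
  exact h

theorem surjective_mulVec_toRows₂ {R : Type*} [CommRing R] {m k : ℕ}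
    {G : Matrix (Fin m ⊕ Fin k) (Fin m ⊕ Fin k) R} (hG : IsUnit G.det) :
    Function.Surjective G.toRows₂.mulVec := by
  intro y
  refine ⟨G⁻¹.mulVec (Sum.elim (0 : Fin m → R) y), ?_⟩
  have h : G.mulVec (G⁻¹.mulVec (Sum.elim (0 : Fin m → R) y)) = Sum.elim (0 : Fin m → R) y := by
    rw [Matrix.mulVec_mulVec, Matrix.mul_nonsing_inv _ hG, Matrix.one_mulVec]
  funext j
  exact congrFun h (Sum.inr j)

/-- With `A` fixed, the last `k` rows of `G` kill `A`, so nonzero characters pulled back along them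
annihilate its columns and are far from flat by `hL`. The factor `det G` is a unit and is absorbed
by unit invariance. -/
theorem IsWeight.abs_sum_det_fromCols_sub_le [IsLocalRing R] (hw : IsWeight w) (h0 : 0 ≤ ρ)
    (h1 : ρ ≤ 1) (hρ : ∀ ψ, ¬ IsFlat w ψ → ‖charSum w ψ‖ ≤ ρ) {m k L : ℕ} [NeZero k]
    {A : Matrix (Fin m ⊕ Fin k) (Fin m) R} (hA : IsResiduallyInjective A)
    (hL : IsSpreadMatrix w L A) (x : R) :
    |∑ C : Matrix (Fin m ⊕ Fin k) (Fin k) R with (Matrix.fromCols A C).det = x, matWeight w C -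
        detProb (uniformWeight R) (Fin k) x| ≤
      Fintype.card (Matrix (Fin k) (Fin k) R) * (k * ρ ^ L) := by
  obtain ⟨G, ⟨u, hu⟩, hGA⟩ := hA.exists_mul_eq_fromRows
  have hφA := toRows₂_mul_eq_zero hGA
  have h2 := hw.abs_sum_det_mul_sub_le G.toRows₂ (fun y =>
    hw.abs_sum_mulVec_eq_sub_le h0 h1 hρ G.toRows₂ (L := L) (fun χ hχ => by
      refine (hL _ (exists_pullbackChar_ne_zero
        (surjective_mulVec_toRows₂ (hu ▸ u.isUnit)) hχ) fun j => ?_).le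
      refine annihilates_pullbackChar χ ?_
      funext i
      exact congrFun (congrFun hφA i) j) y) (u * x)
  rw [detProb_uniformWeight_mul, Fintype.card_fin] at h2
  convert h2 using 5
  rw [← det_mul_det_fromCols hGA, ← hu]
  exact (Units.mul_right_inj u).symm

theorem detProb_eq_sum_fromCols (w : R → ℝ) (m k : ℕ) (x : R) :
    detProb w (Fin m ⊕ Fin k) x = ∑ A : Matrix (Fin m ⊕ Fin k) (Fin m) R, matWeight w A *
      ∑ C : Matrix (Fin m ⊕ Fin k) (Fin k) R with (Matrix.fromCols A C).det = x,
        matWeight w C := by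
  simp only [Finset.sum_filter, Finset.mul_sum, detProb]
  rw [← Fintype.sum_prod_type']
  symm
  refine Finset.sum_bij' (fun P _ => Matrix.fromCols P.1 P.2)
    (fun M _ => (M.toCols₁, M.toCols₂)) ?_ ?_ ?_ ?_ ?_
  · simp
  · simp
  · simp
  · simp
  · intro P _
    have : matWeight w (Matrix.fromCols P.1 P.2) = matWeight w P.1 * matWeight w P.2 := by
      simp [matWeight, vecWeight, Fintype.prod_sum_type, Finset.prod_mul_distrib]
    rw [this, mul_ite, mul_zero]

theorem detProb_congr (w : R → ℝ) {ι κ : Type*} [Fintype ι] [DecidableEq ι] [Fintype κ]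
    [DecidableEq κ] (e : ι ≃ κ) (x : R) : detProb w ι x = detProb w κ x := by
  refine Finset.sum_bij' (fun A _ => A.submatrix e.symm e.symm) (fun A _ => A.submatrix e e)
    ?_ ?_ ?_ ?_ ?_
  · simp
  · simp
  · simp
  · simp
  · intro A _
    simp only [matWeight, vecWeight, Matrix.row_apply, Matrix.submatrix_apply]
    rw [← e.prod_comp]
    refine Finset.prod_congr rfl fun i _ => ?_
    rw [← e.prod_comp]
    simp

theorem IsWeight.detProb_nonneg (hw : IsWeight w) (ι : Type*) [Fintype ι] [DecidableEq ι]
    (x : R) : 0 ≤ detProb w ι x :=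
  Finset.sum_nonneg fun A _ => hw.matWeight_nonneg A

theorem IsWeight.detProb_le_one (hw : IsWeight w) (ι : Type*) [Fintype ι] [DecidableEq ι]
    (x : R) : detProb w ι x ≤ 1 := by
  have h : ∑ A : Matrix ι ι R, matWeight w A = 1 := by convert hw.sum_matWeight
  rw [← h]
  exact Finset.sum_le_sum_of_subset_of_nonneg (Finset.filter_subset _ _)
    fun a _ _ => hw.matWeight_nonneg a

theorem isWeight_uniformWeight (R : Type*) [Fintype R] [Nonempty R] :
    IsWeight (uniformWeight R) where
  nonneg x := by simp [uniformWeight]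
  sum_eq_one := by simp [uniformWeight]

variable [IsLocalRing R]

/-- Condition on `A`: one `ε` each for residual degeneracy, for failure of spread, and for the
Fourier error on good `A`. -/
theorem IsSpreadWeight.eventually_abs_detProb_sub_le (hw : IsSpreadWeight w) (k : ℕ) [NeZero k]
    {ε : ℝ} (hε : 0 < ε) (hk : 2 * maxIdealDensity R ^ k ≤ ε) :
    ∀ᶠ n : ℕ in Filter.atTop, ∀ x : R,
      |detProb w (Fin n) x - detProb (uniformWeight R) (Fin k) x| ≤ 3 * ε := by
  obtain ⟨ρ, h0, h1, hρ⟩ := hw.exists_charSum_bound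
  have hsq : Filter.Tendsto Nat.sqrt Filter.atTop Filter.atTop :=
    Filter.tendsto_atTop_atTop.2 fun b => ⟨b * b, fun a ha => Nat.le_sqrt.2 ha⟩
  have hlim : Filter.Tendsto (fun m : ℕ => (Fintype.card (Matrix (Fin k) (Fin k) R) : ℝ) *
      (k * ρ ^ m.sqrt)) Filter.atTop (nhds 0) := by
    have := (((tendsto_pow_atTop_nhds_zero_of_lt_one h0.le h1).comp hsq).const_mul
      (k : ℝ)).const_mul (Fintype.card (Matrix (Fin k) (Fin k) R) : ℝ)
    simpa using this
  have hev : ∀ᶠ m : ℕ in Filter.atTop, ∀ x : R,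
      |detProb w (Fin (m + k)) x - detProb (uniformWeight R) (Fin k) x| ≤ 3 * ε := by
    filter_upwards [hw.eventually_not_isResiduallyInjective_le h0.le h1 hρ k,
      hw.eventually_not_isSpreadMatrix_le h0.le h1 hρ k hε, hlim.eventually_le_const hε]
      with m hm1 hm2 hm3 x
    rw [detProb_congr w finSumFinEquiv.symm, detProb_eq_sum_fromCols]
    set F := detProb (uniformWeight R) (Fin k) x with hF
    have hF0 : 0 ≤ F := (isWeight_uniformWeight R).detProb_nonneg _ _
    have hF1 : F ≤ 1 := (isWeight_uniformWeight R).detProb_le_one _ _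
    have hone {a b : ℕ} : ∑ A : Matrix (Fin a ⊕ Fin b) (Fin a) R, matWeight w A = 1 := by
      convert hw.sum_matWeight
    have hone' {a b : ℕ} : ∑ A : Matrix (Fin a ⊕ Fin b) (Fin b) R, matWeight w A = 1 := by
      convert hw.sum_matWeight
    set c : Matrix (Fin m ⊕ Fin k) (Fin m) R → ℝ := fun A =>
      ∑ C : Matrix (Fin m ⊕ Fin k) (Fin k) R with (Matrix.fromCols A C).det = x,
        matWeight w C with hc
    have hc0 (A) : 0 ≤ c A := Finset.sum_nonneg fun C _ => hw.matWeight_nonneg C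
    have hc1 (A) : c A ≤ 1 := by
      rw [← hone' (a := m) (b := k)]
      exact Finset.sum_le_sum_of_subset_of_nonneg (Finset.filter_subset _ _)
        fun a _ _ => hw.matWeight_nonneg a
    have hF' : F = ∑ A : Matrix (Fin m ⊕ Fin k) (Fin m) R, matWeight w A * F := by
      rw [← Finset.sum_mul, hone, one_mul]
    rw [hF', ← Finset.sum_sub_distrib]
    refine (Finset.abs_sum_le_sum_abs _ _).trans ?_
    have hterm (A : Matrix (Fin m ⊕ Fin k) (Fin m) R) :
        |matWeight w A * c A - matWeight w A * F| ≤ matWeight w A * ε +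
          ((if ¬ IsResiduallyInjective A then matWeight w A else 0) +
          if ¬ IsSpreadMatrix w m.sqrt A then matWeight w A else 0) := by
      have hA := hw.matWeight_nonneg A
      rw [← mul_sub, abs_mul, abs_of_nonneg hA]
      have h4 : 0 ≤ matWeight w A * ε := mul_nonneg hA hε.le
      have h5 : matWeight w A * |c A - F| ≤ matWeight w A :=
        mul_le_of_le_one_right hA (abs_le.2 ⟨by linarith [hc0 A], by linarith [hc1 A]⟩)
      by_cases hr : IsResiduallyInjective A
      · by_cases hs : IsSpreadMatrix w m.sqrt A
        · simp only [hr, hs, not_true, if_false, add_zero]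
          exact mul_le_mul_of_nonneg_left
            ((hw.abs_sum_det_fromCols_sub_le h0.le h1.le hρ hr hs x).trans hm3) hA
        · simp only [hr, hs, not_true, not_false_eq_true, if_true, if_false]
          linarith
      · simp only [hr, not_false_eq_true, if_true]
        have : 0 ≤ if ¬ IsSpreadMatrix w m.sqrt A then matWeight w A else 0 := by
          split_ifs <;> simp [hA]
        linarith
    refine (Finset.sum_le_sum fun A _ => hterm A).trans ?_
    rw [Finset.sum_add_distrib, Finset.sum_add_distrib, ← Finset.sum_mul, hone,
      ← Finset.sum_filter, ← Finset.sum_filter]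
    linarith
  obtain ⟨m₀, hm₀⟩ := Filter.eventually_atTop.1 hev
  filter_upwards [Filter.eventually_ge_atTop (m₀ + k)] with n hn
  have := hm₀ (n - k) (by omega)
  rwa [Nat.sub_add_cancel (by omega)] at this

/-- Two nondegenerate weights give asymptotically the same distribution of the determinant. -/
theorem IsSpreadWeight.eventually_abs_detProb_sub_detProb_le {w' : R → ℝ} (hw : IsSpreadWeight w)
    (hw' : IsSpreadWeight w') {ε : ℝ} (hε : 0 < ε) :
    ∀ᶠ n : ℕ in Filter.atTop, ∀ x : R, |detProb w (Fin n) x - detProb w' (Fin n) x| ≤ ε := by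
  have hlim : Filter.Tendsto (fun k : ℕ => 2 * maxIdealDensity R ^ k) Filter.atTop (nhds 0) := by
    simpa using (tendsto_pow_atTop_nhds_zero_of_lt_one maxIdealDensity_pos.le
      (maxIdealDensity_lt_one (R := R))).const_mul 2
  obtain ⟨k, hk, hk1⟩ := ((hlim.eventually_le_const (show 0 < ε / 6 by positivity)).and
    (Filter.eventually_ge_atTop 1)).exists
  have : NeZero k := ⟨by omega⟩
  filter_upwards [hw.eventually_abs_detProb_sub_le k (by positivity) hk,
    hw'.eventually_abs_detProb_sub_le k (by positivity) hk] with n h1 h2 x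
  have := abs_sub_le (detProb w (Fin n) x) (detProb (uniformWeight R) (Fin k) x)
    (detProb w' (Fin n) x)
  have h3 := h2 x
  rw [abs_sub_comm] at h3
  linarith [h1 x]

end Determinant

/-! ### From measures to weights, and total variation. -/

section Law

variable {R : Type*} [CommRing R] [Fintype R] [MeasurableSpace R] [MeasurableSingletonClass R]

theorem isWeight_measureReal {R : Type*} [Fintype R] [MeasurableSpace R]
    [MeasurableSingletonClass R] (ξ : Measure R) [IsProbabilityMeasure ξ] :
    IsWeight fun r => ξ.real {r} where
  nonneg _ := measureReal_nonneg
  sum_eq_one := by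
    rw [sum_measureReal_singleton]
    simp

theorem ae_of_forall_measureReal_singleton_ne_zero {R : Type*} [Fintype R]
    [MeasurableSpace R] [MeasurableSingletonClass R] {ξ : Measure R} [IsProbabilityMeasure ξ]
    {p : R → Prop} (h : ∀ x, ξ.real {x} ≠ 0 → p x) : ∀ᵐ x ∂ξ, p x := by
  rw [ae_iff, ← measureReal_eq_zero_iff]
  have h2 := sum_measureReal_singleton (μ := ξ) ({x | ¬ p x} : Finset R)
  rw [Finset.coe_filter] at h2
  simp only [Finset.mem_univ, true_and] at h2
  rw [← h2]
  refine Finset.sum_eq_zero fun x hx => ?_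
  by_contra hne
  exact (Finset.mem_filter.1 hx).2 (h x hne)

theorem isSpreadWeight_measureReal [IsLocalRing R] (ξ : Measure R) [IsProbabilityMeasure ξ]
    (hideal : NotOnIdealTranslate ξ) (hsubring : NotOnSubringTranslate ξ) :
    IsSpreadWeight fun r => ξ.real {r} where
  toIsWeight := isWeight_measureReal ξ
  exists_unit := by
    by_contra! h
    obtain ⟨y, hy⟩ : ∃ y, ξ.real {y} ≠ 0 := by
      by_contra! h0
      have := (isWeight_measureReal ξ).sum_eq_one
      simp [h0] at this
    -- If no difference of charged points is a unit, the support lies in `y` plus the maximal ideal.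
    refine hideal (IsLocalRing.maximalIdeal R) (Ideal.IsPrime.ne_top inferInstance) y
      (ae_of_forall_measureReal_singleton_ne_zero fun x hx => ⟨x - y, ?_, by simp⟩)
    exact (IsLocalRing.mem_maximalIdeal _).2 (h x y hx hy)
  eq_top S a c h := by
    by_contra hS
    refine hsubring S hS a c (ae_of_forall_measureReal_singleton_ne_zero fun x hx => ?_)
    obtain ⟨s, hs, rfl⟩ := h x hx
    exact ⟨s, hs, rfl⟩

theorem isSpreadWeight_uniformWeight {R : Type*} [CommRing R] [Fintype R] [IsLocalRing R] :
    IsSpreadWeight (uniformWeight R) where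
  toIsWeight := isWeight_uniformWeight R
  exists_unit := ⟨1, 0, by simp [uniformWeight], by simp [uniformWeight], by simp⟩
  eq_top S a c h := by
    refine (Subring.eq_top_iff' S).2 fun x => ?_
    obtain ⟨s, hs, hx⟩ := h (a + c * x) (by simp [uniformWeight])
    have : x = s := by simpa using hx
    rwa [this]

theorem measureReal_uniformOn_singleton {R : Type*} [Fintype R] [MeasurableSpace R]
    [MeasurableSingletonClass R] (r : R) :
    (uniformOn (Set.univ : Set R)).real {r} = uniformWeight R r := by
  rw [measureReal_def, uniformOn_univ]
  simp [uniformWeight]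

theorem map_det_measureReal_singleton {Ω : Type*} [MeasurableSpace Ω] {P : Measure Ω}
    [IsProbabilityMeasure P] {n : ℕ} {M : Ω → Matrix (Fin n) (Fin n) R} {ξ : Measure R}
    [IsProbabilityMeasure ξ] (hM : IsIIDMatrix M ξ P) (x : R) :
    (P.map fun ω => (M ω).det).real {x} = detProb (fun r => ξ.real {r}) (Fin n) x := by
  have hae (ij : Fin n × Fin n) : AEMeasurable (fun ω => M ω ij.1 ij.2) P :=
    (hM.1 ij.1 ij.2).aemeasurable
  have hpi : P.map (fun ω (ij : Fin n × Fin n) => M ω ij.1 ij.2) = Measure.pi fun _ => ξ := by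
    rw [(iIndepFun_iff_map_fun_eq_pi_map hae).1 hM.2]
    congr 1
    funext ij
    exact (hM.1 ij.1 ij.2).map_eq
  let D : (Fin n × Fin n → R) → R := fun f => (Matrix.of fun i j => f (i, j)).det
  have hD : Measurable D := measurable_of_countable D
  have hmap : (P.map fun ω => (M ω).det) = (Measure.pi fun _ : Fin n × Fin n => ξ).map D := by
    rw [← hpi, AEMeasurable.map_map_of_aemeasurable hD.aemeasurable (aemeasurable_pi_iff.2 hae)]
    rfl
  rw [hmap, map_measureReal_apply hD (measurableSet_singleton x)]
  have hset : D ⁻¹' {x} = (({f | D f = x} : Finset (Fin n × Fin n → R)) : Set _) := by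
    ext f; simp
  rw [hset, ← sum_measureReal_singleton, detProb]
  refine Finset.sum_bij' (fun f _ => Matrix.of fun i j => f (i, j)) (fun A _ ij => A ij.1 ij.2)
    ?_ ?_ ?_ ?_ ?_
  · intro f hf
    simpa [D] using hf
  · intro A hA
    exact Finset.mem_filter.2 ⟨Finset.mem_univ _, (Finset.mem_filter.1 hA).2⟩
  · intro f _; rfl
  · intro A _; rfl
  · intro f _
    rw [measureReal_def, Measure.pi_singleton, ENNReal.toReal_prod, Fintype.prod_prod_type]
    rfl

theorem tvDist_le_of_forall_singleton {μ ν : Measure R} [IsFiniteMeasure μ] [IsFiniteMeasure ν]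
    {ε : ℝ} (h : ∀ x, |μ.real {x} - ν.real {x}| ≤ ε) : tvDist μ ν ≤ Fintype.card R * ε := by
  have hε : 0 ≤ ε := (abs_nonneg _).trans (h 0)
  refine Real.iSup_le (fun A => ?_) (by positivity)
  have hA (κ : Measure R) [IsFiniteMeasure κ] :
      κ.real A.1 = ∑ x : R with x ∈ A.1, κ.real {x} := by
    rw [sum_measureReal_singleton, Finset.coe_filter]
    congr 1
    ext x
    simp
  rw [hA μ, hA ν, ← Finset.sum_sub_distrib]
  refine (Finset.abs_sum_le_sum_abs _ _).trans ?_
  refine (Finset.sum_le_card_nsmul _ _ _ fun x _ => h x).trans ?_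
  rw [nsmul_eq_mul]
  exact mul_le_mul_of_nonneg_right (Nat.cast_le.2 (Finset.card_le_univ _)) hε

theorem tvDist_nonneg {X : Type*} [MeasurableSpace X] (μ ν : Measure X) : 0 ≤ tvDist μ ν :=
  Real.iSup_nonneg fun _ => abs_nonneg _

end Law

end RandomDeterminant

open RandomDeterminant in
theorem mainTheorem9 {R : Type*} [CommRing R] [IsLocalRing R] [Finite R]
    [MeasurableSpace R] [MeasurableSingletonClass R]
    (ξ : Measure R) [IsProbabilityMeasure ξ]
    (hideal : NotOnIdealTranslate ξ) (hsubring : NotOnSubringTranslate ξ)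
    {Ω Ω' : ℕ → Type*} [∀ n, MeasurableSpace (Ω n)] [∀ n, MeasurableSpace (Ω' n)]
    (P : ∀ n, Measure (Ω n)) [∀ n, IsProbabilityMeasure (P n)]
    (P' : ∀ n, Measure (Ω' n)) [∀ n, IsProbabilityMeasure (P' n)]
    (M : ∀ n, Ω n → Matrix (Fin n) (Fin n) R) (hM : ∀ n, IsIIDMatrix (M n) ξ (P n))
    (U : ∀ n, Ω' n → Matrix (Fin n) (Fin n) R)
    (hU : ∀ n, IsIIDMatrix (U n) (uniformOn (Set.univ : Set R)) (P' n)) :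
    Filter.Tendsto
      (fun n => tvDist ((P n).map fun ω => (M n ω).det) ((P' n).map fun ω => (U n ω).det))
      Filter.atTop (nhds 0) := by
  have := Fintype.ofFinite R
  have : IsProbabilityMeasure (uniformOn (Set.univ : Set R)) :=
    isProbabilityMeasure_uniformOn Set.finite_univ Set.univ_nonempty
  have hN : (0 : ℝ) < Fintype.card R := Nat.cast_pos.2 Fintype.card_pos
  have hunif : (fun r => (uniformOn (Set.univ : Set R)).real {r}) = uniformWeight R :=
    funext measureReal_uniformOn_singleton
  refine Metric.tendsto_atTop'.2 fun ε hε => ?_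
  have hev := (isSpreadWeight_measureReal ξ hideal hsubring).eventually_abs_detProb_sub_detProb_le
    isSpreadWeight_uniformWeight (show 0 < ε / 2 / Fintype.card R by positivity)
  obtain ⟨n₀, hn₀⟩ := Filter.eventually_atTop.1 hev
  refine ⟨n₀, fun n hn => ?_⟩
  rw [Real.dist_eq, sub_zero, abs_of_nonneg (tvDist_nonneg _ _)]
  refine (tvDist_le_of_forall_singleton (ε := ε / 2 / Fintype.card R) fun x => ?_).trans_lt ?_
  · rw [map_det_measureReal_singleton (hM n), map_det_measureReal_singleton (hU n), hunif]
    exact hn₀ n hn.le x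
  · rw [mul_div_cancel₀ _ hN.ne']
    linarith
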